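/- **Conventions.** For $u\in\mathbf C$, $\sqrt u$ has positive real part if $u\notin(-\infty,0]$ and positive imaginary part if $u\in(-\infty,0)$; $\log u$ ($u\ne0$) has imaginary part in $(-\pi,\pi]$; $\cosh^{-1}u$ has real part $\ge 0$ and imaginary part in $(-\pi,\pi]$, and imaginary part in $[0,\pi]$ if the real part is $0$. Fix $\tau\in\mathbf C$ and put $\mu=\tau+2$, $\nu=\cosh^{-1}(-\tau/2)=\cosh^{-1}(1-\mu/2)$. Assume $\mu\neq0,4$. Define $$h(x)=\tfrac12\Big(1-\sqrt{1-4/x^2}\Big),\qquad \mathfrak h_\tau(x)=\log\frac{1+(e^{\nu}-1)h(x)}{1+(e^{-\nu}-1)h(x)},\qquad \hat{\mathfrak h}_\tau(x)=\log\frac{1+(e^{\nu}-1)h(x)}{\sqrt{1-\mu/x^2}}$$ for $x\ne 0$, $x^2\neq\mu$, and $$\Psi_\mu(x,y,z)=\log\frac{1+(e^\nu-1)\,z/(xy)}{\sqrt{1-\mu/x^2}\,\sqrt{1-\mu/y^2}}\qquad(x,y\neq 0,\ x^2,y^2\ne\mu).$$ Let $\Sigma$ be the binary tree dual to the Farey tessellation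 of the hyperbolic plane, and let $\Omega$ be its set of complementary regions, identified with $\mathbf Q\cup\{\infty\}$ (regions $p/q$ and $p'/q'$ in lowest terms, with $\infty=1/0$, share an edge of $\Sigma$ iff $|pq'-p'q|=1$). A directed edge $\vec e=(X,Y;Z\to W)$ is an edge $e=X\cap Y$ of $\Sigma$ directed from its end point on $Z$ (its tail) to its end point on $W$ (its head). Put $\Omega^0(e)=\{X,Y\}$; let $\Sigma^-(\vec e)$ be the component of $\Sigma\setminus\mathrm{int}(e)$ that contains the tail, $\Omega^-(\vec e)$ the set of regions whose boundary lies entirely in $\Sigma^-(\vec e)$, and $\Omega^{0-}(\vec e)=\Omega^0(e)\cup\Omega^-(\vec e)$. A $\mu$-Markoff map is a map $\phi:\Omega\to\mathbf C$ such that $x^2+y^2+z^2-xyz=\mu$ for the values $x,y,z$ of $\phi$ at the three regions meeting at any vertex of $\Sigma$, and $\phi(X)\phi(Y)=\phi(Z)+\phi(W)$ for every edge $X\cap Y$ with end points on $Z$ and $W$. For such $\phi$ put $\psi(\vec e)=\Psi_\mu(\phi(X),\phi(Y),\phi(W))$ for $\vec e=(X,Y;Z\to W)$. **Proposition.** Let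 $\phi$ be a $\mu$-Markoff map, $\mu=\tau+2\ne0,4$, and let $\vec e$ be a directed edge with $\Omega^0(e)=\{X_0,Y_0\}$ such that $\phi(X_0)=\pm2$ and $X_0$ is the only region in $\Omega^{0-}(\vec e)$ with $|\phi|\le2$. Then $\phi(X)^2\neq\mu$ for all $X\in\Omega^-(\vec e)$ (so that the terms below are defined), the sum $\sum_{X\in\Omega^-(\vec e)}\mathfrak h_\tau(\phi(X))$ converges absolutely, and, provided $\phi(Y_0)^2\neq\mu$ (so that $\hat{\mathfrak h}_\tau(\phi(Y_0))$ and $\psi(\vec e)$ are defined), $$\sum_{X\in\Omega^0(e)}\hat{\mathfrak h}_\tau(\phi(X))+\sum_{X\in\Omega^-(\vec e)}\mathfrak h_\tau(\phi(X))=\psi(\vec e)\mod 2\pi i.$$ -/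

import Mathlib

namespace Markoff

noncomputable section

/-! ### Elementary complex functions

`Complex.sqrt` and `Complex.log` are the principal branches: `√u` has positive real part for
`u ∉ (-∞, 0]` and positive imaginary part for `u ∈ (-∞, 0)`, and `log u` has imaginary part
in `(-π, π]`. -/

/-- The principal inverse hyperbolic cosine; `arcosh_spec` shows that it is the branch with
real part `≥ 0`, imaginary part in `(-π, π]`, and imaginary part `≥ 0` if the real part is `0`. -/
def arcosh (u : ℂ) : ℂ :=
  Complex.log (u + Complex.sqrt (u + 1) * Complex.sqrt (u - 1))

/-- The branch of the inverse hyperbolic cosine that `arcosh` is. -/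
theorem arcosh_spec (u : ℂ) :
    Complex.cosh (arcosh u) = u ∧ 0 ≤ (arcosh u).re ∧
      (arcosh u).im ∈ Set.Ioc (-Real.pi) Real.pi ∧
      ((arcosh u).re = 0 → 0 ≤ (arcosh u).im) := by
  have sq : ∀ w : ℂ, Complex.sqrt w ^ 2 = w := fun w => by
    have := Complex.cpow_nat_inv_pow w (n := 2) two_ne_zero
    exact this
  have re0 : ∀ w : ℂ, 0 ≤ (Complex.sqrt w).re := fun w => by
    rw [Complex.sqrt, Complex.cpow_inv_two_re]; positivity
  have im0 : ∀ w : ℂ, 0 ≤ w.im → 0 ≤ (Complex.sqrt w).im := fun w hw => by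
    rw [Complex.sqrt_eq_real_add_ite, if_pos hw]; simp; positivity
  have im1 : ∀ w : ℂ, w.im < 0 → (Complex.sqrt w).im ≤ 0 := fun w hw => by
    rw [Complex.sqrt_eq_real_add_ite, if_neg (not_le.2 hw)]; simp; positivity
  have ha := sq (u + 1)
  have hb := sq (u - 1)
  have ar := re0 (u + 1)
  have br := re0 (u - 1)
  have ai := im0 (u + 1)
  have bi := im0 (u - 1)
  have ai' := im1 (u + 1)
  have bi' := im1 (u - 1)
  unfold arcosh
  generalize Complex.sqrt (u + 1) = a at *
  generalize Complex.sqrt (u - 1) = b at *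
  simp only [Complex.add_im, Complex.sub_im, Complex.one_im, add_zero, sub_zero] at ai bi ai' bi'
  have hprod : 0 ≤ a.im * b.im := by
    rcases le_or_gt 0 u.im with hu | hu
    · exact mul_nonneg (ai hu) (bi hu)
    · exact mul_nonneg_of_nonpos_of_nonpos (ai' hu) (bi' hu)
  have hvv : (u + a * b) * (u - a * b) = 1 := by
    have : (u + a * b) * (u - a * b) = u ^ 2 - a ^ 2 * b ^ 2 := by ring
    rw [this, ha, hb]; ring
  have hv0 : u + a * b ≠ 0 := left_ne_zero_of_mul_eq_one hvv
  have h1 : u + a * b = (a + b) ^ 2 / 2 := by linear_combination (-1 / 2) * ha - hb / 2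
  have h2 : u - a * b = (a - b) ^ 2 / 2 := by linear_combination (-1 / 2) * ha - hb / 2
  have hsub : Complex.normSq (a + b) - Complex.normSq (a - b)
      = 4 * (a.re * b.re + a.im * b.im) := by
    simp [Complex.normSq_apply]; ring
  have n1 : ‖u + a * b‖ = Complex.normSq (a + b) / 2 := by
    rw [h1]; simp [Complex.normSq_eq_norm_sq]
  have n2 : ‖u - a * b‖ = Complex.normSq (a - b) / 2 := by
    rw [h2]; simp [Complex.normSq_eq_norm_sq]
  have hn : ‖u + a * b‖ * ‖u - a * b‖ = 1 := by rw [← norm_mul, hvv, norm_one]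
  have hrr := mul_nonneg ar br
  have hge : 1 ≤ ‖u + a * b‖ := by
    by_contra hlt
    push Not at hlt
    nlinarith [norm_nonneg (u + a * b), norm_nonneg (u - a * b)]
  refine ⟨?_, ?_, ?_, ?_⟩
  · have hinv : (u + a * b)⁻¹ = u - a * b := inv_eq_of_mul_eq_one_right hvv
    rw [Complex.cosh, Complex.exp_neg, Complex.exp_log hv0, hinv]
    ring
  · rw [Complex.log_re]; exact Real.log_nonneg hge
  · rw [Complex.log_im]; exact Complex.arg_mem_Ioc _
  · intro hre
    rw [Complex.log_re] at hre
    have hone : ‖u + a * b‖ = 1 := by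
      rcases Real.log_eq_zero.1 hre with h | h | h <;> linarith
    rw [Complex.log_im, Complex.arg_nonneg_iff]
    rw [hone, one_mul] at hn
    have hz : a.re * b.re + a.im * b.im = 0 := by linarith
    have hi : u.im = 2 * (a.re * a.im) := by
      have := congrArg Complex.im ha
      simp [pow_two] at this; linarith
    have hi' : u.im = 2 * (b.re * b.im) := by
      have := congrArg Complex.im hb
      simp [pow_two] at this; linarith
    rcases le_or_gt 0 u.im with hu | hu
    · have := ai hu
      have := bi hu
      rw [Complex.add_im, Complex.mul_im]
      positivity
    · exfalso
      have z1 : a.re * b.re = 0 := by linarith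
      rcases mul_eq_zero.1 z1 with h | h
      · rw [h] at hi; linarith
      · rw [h] at hi'; linarith

/-- `h(x) = (1 - √(1 - 4 / x²)) / 2`, for `x ≠ 0`. -/
def h (x : ℂ) : ℂ := (1 - Complex.sqrt (1 - 4 / x ^ 2)) / 2

/-- `ν = cosh⁻¹(-τ / 2)`. -/
def nu (τ : ℂ) : ℂ := arcosh (-τ / 2)

/-- `𝔥_τ(x) = log ((1 + (e^ν - 1) h(x)) / (1 + (e^{-ν} - 1) h(x)))`, for `x² ≠ τ + 2`. -/
def frakH (τ x : ℂ) : ℂ :=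
  Complex.log ((1 + (Complex.exp (nu τ) - 1) * h x) / (1 + (Complex.exp (-nu τ) - 1) * h x))

/-- `𝔥̂_τ(x) = log ((1 + (e^ν - 1) h(x)) / √(1 - μ / x²))` with `μ = τ + 2`, for `x² ≠ μ`. -/
def hatFrakH (τ x : ℂ) : ℂ :=
  Complex.log ((1 + (Complex.exp (nu τ) - 1) * h x) / Complex.sqrt (1 - (τ + 2) / x ^ 2))

/-- `Ψ_μ(x, y, z) = log ((1 + (e^ν - 1) z / (x y)) / (√(1 - μ / x²) √(1 - μ / y²)))` with
`ν = cosh⁻¹(1 - μ / 2)`, for `x, y ≠ 0` and `x², y² ≠ μ`. -/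
def Psi (μ x y z : ℂ) : ℂ :=
  Complex.log ((1 + (Complex.exp (arcosh (1 - μ / 2)) - 1) * (z / (x * y))) /
    (Complex.sqrt (1 - μ / x ^ 2) * Complex.sqrt (1 - μ / y ^ 2)))

/-! ### The Farey tessellation and its dual binary tree -/

/-- The complementary regions of the binary tree, identified with `ℚ ∪ {∞}`. -/
abbrev Region : Type := OnePoint ℚ

instance : DecidableEq Region := inferInstanceAs (DecidableEq (Option ℚ))

/-- Numerator in lowest terms, where `∞ = 1/0`. -/
def num (X : Region) : ℤ := X.elim 1 (fun r => r.num)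

/-- Denominator in lowest terms, where `∞ = 1/0`. -/
def den (X : Region) : ℤ := X.elim 0 (fun r => (r.den : ℤ))

/-- The Farey graph: `p/q` and `p'/q'` are neighbours iff `|p q' - p' q| = 1`.  Two regions are
neighbours iff they share an edge of the dual tree. -/
def farey : SimpleGraph Region where
  Adj X Y := |num X * den Y - num Y * den X| = 1
  symm := ⟨fun X Y hXY => by rw [abs_sub_comm]; exact hXY⟩
  loopless := ⟨fun X hX => by simp at hX⟩

/-- The vertices of the tree, i.e. the ideal triangles of the Farey tessellation.  A vertex is
given by the set of the three regions that meet there. -/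
abbrev Vertex : Type := {t : Finset Region // farey.IsNClique 3 t}

/-- The tree dual to the Farey tessellation: two triangles are joined iff they share a side. -/
def tree : SimpleGraph Vertex where
  Adj s t := (s.1 ∩ t.1).card = 2
  symm := ⟨fun s t hst => by rw [Finset.inter_comm]; exact hst⟩
  loopless := ⟨fun s hs => by rw [Finset.inter_self, s.2.card_eq] at hs; omega⟩

/-- A directed edge `(X, Y; Z → W)` of the tree: it is the common side of the regions `X` and
`Y`, and it runs from its end point on `Z` to its end point on `W`. -/
structure DirectedEdge where
  X : Region
  Y : Region
  Z : Region
  W : Region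
  adjXY : farey.Adj X Y
  adjXZ : farey.Adj X Z
  adjYZ : farey.Adj Y Z
  adjXW : farey.Adj X W
  adjYW : farey.Adj Y W
  Z_ne_W : Z ≠ W

namespace DirectedEdge

/-- The tail, where `X, Y, Z` meet. -/
def tail (e : DirectedEdge) : Vertex :=
  ⟨{e.X, e.Y, e.Z}, SimpleGraph.is3Clique_iff.2
    ⟨e.X, e.Y, e.Z, e.adjXY, e.adjXZ, e.adjYZ, rfl⟩⟩

/-- The head, where `X, Y, W` meet. -/
def head (e : DirectedEdge) : Vertex :=
  ⟨{e.X, e.Y, e.W}, SimpleGraph.is3Clique_iff.2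
    ⟨e.X, e.Y, e.W, e.adjXY, e.adjXW, e.adjYW, rfl⟩⟩

/-- `Ω⁰(e)`: the two regions whose common side is `e`. -/
def omegaZero (e : DirectedEdge) : Finset Region := {e.X, e.Y}

/-- The vertices of `Σ⁻(e)`, the component of the tree minus the interior of `e` that contains
the tail of `e`. -/
def sigmaMinus (e : DirectedEdge) : Set Vertex :=
  {v | (tree.deleteEdges {s(e.tail, e.head)}).Reachable e.tail v}

/-- `Ω⁻(e)`: the regions whose boundary lies entirely in `Σ⁻(e)`.  The vertices on the boundary
of a region are the Farey triangles that have it as a corner. -/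
def omegaMinus (e : DirectedEdge) : Set Region :=
  {X | ∀ v : Vertex, X ∈ v.1 → v ∈ e.sigmaMinus}

/-- `Ω⁰⁻(e) = Ω⁰(e) ∪ Ω⁻(e)`. -/
def omegaZeroMinus (e : DirectedEdge) : Set Region := ↑e.omegaZero ∪ e.omegaMinus

end DirectedEdge

/-! ### Markoff maps -/

/-- `φ` is a `μ`-Markoff map: it satisfies the vertex relation at every vertex and the edge
relation along every edge. -/
structure IsMarkoffMap (μ : ℂ) (φ : Region → ℂ) : Prop where
  vertex : ∀ X Y Z : Region, farey.Adj X Y → farey.Adj X Z → farey.Adj Y Z →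
    φ X ^ 2 + φ Y ^ 2 + φ Z ^ 2 - φ X * φ Y * φ Z = μ
  edge : ∀ e : DirectedEdge, φ e.X * φ e.Y = φ e.Z + φ e.W

/-- `Ω_φ(k)`: the regions on which `|φ| ≤ k`. -/
def sublevel (φ : Region → ℂ) (k : ℝ) : Set Region := {X | ‖φ X‖ ≤ k}

/-- The edge weight `ψ(e) = Ψ_μ(φ(X), φ(Y), φ(W))`, where `e = (X, Y; Z → W)`, so that `W` is
the region at the head of `e`. -/
def psi (μ : ℂ) (φ : Region → ℂ) (e : DirectedEdge) : ℂ := Psi μ (φ e.X) (φ e.Y) (φ e.W)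

end

end Markoff

/-!
All identities are exponentiated, which turns congruences modulo `2πi` into equalities. With
`E = e ^ ν` one has `(E - 1)² = -μ E`, and `h (1 - h) = 1 / x²`, so
`(1 + (E - 1) h) (1 + (E⁻¹ - 1) h) = 1 - μ / x²`. Hence the *defect*
`exp (Ψ_μ(x, y, w) - 𝔥̂_τ(x) - 𝔥̂_τ(y))` of an edge contains no square roots, and the vertex relation
says that the defect of an edge is `exp 𝔥_τ(z)` times the product of the defects of the two edges
behind its tail, `z` being the value at the tail (`defect_eq_mul`).

In a basis of `ℤ²` adapted to the edge `e`, the set `Ω⁻(e)` is the set of primitive vectors with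
positive coordinates (`DirectedEdge.IsBasis.mem_omegaMinus_iff`), and the two edges behind an edge
give the Stern-Brocot decomposition of that cone (`coneSum_eq_add`). Therefore the quotient of the
defect by the exponential of the sum of `𝔥_τ` over the cone, `edgeRatio`, is multiplicative along
the tree, and the claim is that it equals `1`.

Let `X₀` correspond to `(1, 0)`. As `φ(X₀) = ±2`, the values at its neighbours `(n, 1)` are up to
sign an arithmetic progression whose step is a square root of `μ - 4 ≠ 0` (`IsMarkoffFun.fan_eq`),
so for `n ≥ 0` their moduli tend to infinity and are at least some `m > 2`. Behind the edges between
consecutive neighbours the function `(1 - 1 / m) |φ|` is supermultiplicative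
(`GoodEdge.weight_add_le`). Comparison with a product of geometric series gives
`Σ |φ|⁻² < ∞` (`ParabolicCone.summable_weight`), hence absolute convergence since
`𝔥_τ(x) = O(x⁻²)`. The same bound shows that on these edges `edgeRatio - 1` is of the order of the
product of the weights of the two sides, whose sum over the edges at depth `k` tends to `0`; a
multiplicative function with this property is identically `1` (`eq_one_of_multiplicative`). It
follows that `edgeRatio` is the same for all edges between `(1, 0)` and `(n, 1)`. For `n → ∞` it
tends to `1`, because the ratio `φ(n - 1, 1) / (φ(X₀) φ(n, 1))` tends to `1 / 2 = h(±2)`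
(`ParabolicCone.exp_coneSum`).

Finally, if `φ(X)² = μ` for some `X ∈ Ω⁻(e)`, the values at the neighbours of `X` would satisfy
`y_{n-1} y_{n+1} = y_n²`. All of them have modulus at least `2`, which forces constant modulus and
`|φ(X)| ≤ 2` (`ParabolicCone.sq_ne`).
-/

namespace Markoff

noncomputable section

section Analysis

open Filter Topology Asymptotics Bornology

/-! ### Analysis of `h`, `𝔥` and `Ψ` -/

theorem complex_sqrt_sq (w : ℂ) : Complex.sqrt w ^ 2 = w :=
  Complex.cpow_nat_inv_pow w two_ne_zero

theorem complex_sqrt_ne_zero {w : ℂ} (hw : w ≠ 0) : Complex.sqrt w ≠ 0 := by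
  intro h0
  have := complex_sqrt_sq w
  rw [h0] at this
  exact hw (by simpa using this.symm)

theorem h_mul_one_sub_h (x : ℂ) : h x * (1 - h x) = 1 / x ^ 2 := by
  have hs := complex_sqrt_sq (1 - 4 / x ^ 2)
  unfold h
  linear_combination (-1 / 4) * hs

theorem h_of_eq_two_or {x : ℂ} (hx : x = 2 ∨ x = -2) : h x = 1 / 2 := by
  have h4 : x ^ 2 = 4 := by rcases hx with rfl | rfl <;> norm_num
  have hs := complex_sqrt_sq (1 - 4 / x ^ 2)
  rw [h4, div_self (by norm_num), sub_self, pow_eq_zero_iff two_ne_zero] at hs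
  rw [h, h4, div_self (by norm_num), sub_self, hs, sub_zero]

theorem norm_h_le {x : ℂ} (hx : 2 ≤ ‖x‖) : ‖h x‖ ≤ 1 / (‖x‖ * (‖x‖ - 1)) := by
  have hpos : 0 < ‖x‖ := by linarith
  have key := congrArg norm (h_mul_one_sub_h x)
  rw [norm_mul, norm_div, norm_one, norm_pow] at key
  have hre : 0 ≤ (Complex.sqrt (1 - 4 / x ^ 2)).re := by
    rw [Complex.sqrt, Complex.cpow_inv_two_re]; positivity
  have hle : ‖h x‖ ≤ ‖1 - h x‖ := by
    have h1 : (h x).re ≤ 1 / 2 := by simp [h]; linarith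
    rw [← sq_le_sq₀ (norm_nonneg _) (norm_nonneg _), ← Complex.normSq_eq_norm_sq,
      ← Complex.normSq_eq_norm_sq, Complex.normSq_apply, Complex.normSq_apply]
    simp only [Complex.sub_re, Complex.one_re, Complex.sub_im, Complex.one_im]
    nlinarith
  have h1 : ‖h x‖ ≤ 1 / ‖x‖ := by
    rw [← sq_le_sq₀ (norm_nonneg _) (by positivity), div_pow, one_pow, ← key, pow_two]
    exact mul_le_mul_of_nonneg_left hle (norm_nonneg _)
  have h2 : 1 - 1 / ‖x‖ ≤ ‖1 - h x‖ := by
    have := norm_sub_norm_le 1 (h x)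
    rw [norm_one] at this; linarith
  have h3 : 0 < 1 - 1 / ‖x‖ := by
    rw [sub_pos, div_lt_one hpos]; linarith
  have h4 : ‖h x‖ * (1 - 1 / ‖x‖) ≤ 1 / ‖x‖ ^ 2 :=
    key ▸ mul_le_mul_of_nonneg_left h2 (norm_nonneg _)
  rw [← le_div_iff₀ h3] at h4
  refine h4.trans (le_of_eq ?_)
  have : ‖x‖ - 1 ≠ 0 := by linarith
  field_simp

theorem norm_h_le_two_div_sq {x : ℂ} (hx : 2 ≤ ‖x‖) : ‖h x‖ ≤ 2 / ‖x‖ ^ 2 := by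
  refine (norm_h_le hx).trans ?_
  have hpos : 0 < ‖x‖ := by linarith
  rw [div_le_div_iff₀ (mul_pos hpos (by linarith)) (by positivity)]
  nlinarith

theorem h_isBigO : h =O[cobounded ℂ] fun x => 1 / x ^ 2 := by
  refine IsBigO.of_bound 2 ?_
  filter_upwards [(tendsto_norm_cobounded_atTop (E := ℂ)).eventually_ge_atTop 2] with x hx
  have := norm_h_le_two_div_sq hx
  rw [norm_div, norm_one, norm_pow]
  linarith [this, mul_one_div (2 : ℝ) (‖x‖ ^ 2)]

theorem h_tendsto_zero : Tendsto h (cobounded ℂ) (𝓝 0) := by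
  refine h_isBigO.trans_tendsto ?_
  have : Tendsto (fun x : ℂ => (x⁻¹) ^ 2) (cobounded ℂ) (𝓝 (0 ^ 2)) :=
    (tendsto_inv₀_cobounded (α := ℂ)).pow 2
  simpa using this

/-- The exponential `e ^ ν`, in terms of which all identities are polynomial. -/
def expNu (τ : ℂ) : ℂ := Complex.exp (nu τ)

theorem expNu_ne_zero (τ : ℂ) : expNu τ ≠ 0 := Complex.exp_ne_zero _

theorem expNu_sub_one_sq (τ : ℂ) : (expNu τ - 1) ^ 2 = -(τ + 2) * expNu τ := by
  have hc := (arcosh_spec (-τ / 2)).1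
  have he : Complex.exp (nu τ) * Complex.exp (-nu τ) = 1 := by
    rw [← Complex.exp_add]; simp
  change Complex.cosh (nu τ) = _ at hc
  rw [Complex.cosh] at hc
  unfold expNu
  linear_combination (2 * Complex.exp (nu τ)) * hc - he

/-- The common numerator of the exponentials of `𝔥_τ(x)` and `𝔥̂_τ(x)`. -/
def hNum (τ x : ℂ) : ℂ := 1 + (expNu τ - 1) * h x

/-- The denominator of the exponential of `𝔥_τ(x)`. -/
def hDen (τ x : ℂ) : ℂ := 1 + ((expNu τ)⁻¹ - 1) * h x

theorem hNum_mul_hDen (τ x : ℂ) :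
    hNum τ x * hDen τ x = 1 - (τ + 2) / x ^ 2 := by
  have h1 := h_mul_one_sub_h x
  have h2 := expNu_sub_one_sq τ
  have h3 := mul_inv_cancel₀ (expNu_ne_zero τ)
  have h4 : τ + 2 = -(expNu τ - 1) ^ 2 * (expNu τ)⁻¹ := by
    linear_combination (expNu τ)⁻¹ * h2 - (τ + 2) * h3
  have h5 : (τ + 2) / x ^ 2 = (τ + 2) * (h x * (1 - h x)) := by rw [h1]; ring
  rw [h5, h4]
  unfold hNum hDen
  linear_combination (h x * (2 - expNu τ) + h x ^ 2 * (expNu τ - 1)) * h3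

theorem one_sub_div_sq_ne_zero {μ x : ℂ} (hx : x ≠ 0) (hxμ : x ^ 2 ≠ μ) : 1 - μ / x ^ 2 ≠ 0 := by
  intro h0
  rw [sub_eq_zero, eq_div_iff (pow_ne_zero 2 hx), one_mul] at h0
  exact hxμ h0

theorem hNum_ne_zero {τ x : ℂ} (hx : x ≠ 0) (hxμ : x ^ 2 ≠ τ + 2) : hNum τ x ≠ 0 :=
  left_ne_zero_of_mul (hNum_mul_hDen τ x ▸ one_sub_div_sq_ne_zero hx hxμ)

theorem hDen_ne_zero {τ x : ℂ} (hx : x ≠ 0) (hxμ : x ^ 2 ≠ τ + 2) : hDen τ x ≠ 0 :=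
  right_ne_zero_of_mul (hNum_mul_hDen τ x ▸ one_sub_div_sq_ne_zero hx hxμ)

theorem exp_frakH {τ x : ℂ} (hx : x ≠ 0) (hxμ : x ^ 2 ≠ τ + 2) :
    Complex.exp (frakH τ x) = hNum τ x / hDen τ x := by
  have h1 := hNum_ne_zero hx hxμ
  have h2 := hDen_ne_zero hx hxμ
  unfold frakH
  rw [Complex.exp_neg]
  exact Complex.exp_log (div_ne_zero h1 h2)

theorem exp_hatFrakH {τ x : ℂ} (hx : x ≠ 0) (hxμ : x ^ 2 ≠ τ + 2) :
    Complex.exp (hatFrakH τ x) = hNum τ x / Complex.sqrt (1 - (τ + 2) / x ^ 2) :=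
  Complex.exp_log (div_ne_zero (hNum_ne_zero hx hxμ)
    (complex_sqrt_ne_zero (one_sub_div_sq_ne_zero hx hxμ)))

theorem frakH_isBigO (τ : ℂ) : frakH τ =O[cobounded ℂ] fun x => 1 / x ^ 2 := by
  -- `𝔥_τ` is a function of `h` that is differentiable at `0` and vanishes there.
  let g : ℂ → ℂ := fun t => Complex.log ((1 + (Complex.exp (nu τ) - 1) * t) /
    (1 + (Complex.exp (-nu τ) - 1) * t))
  have hg : DifferentiableAt ℂ g 0 := by
    apply DifferentiableAt.clog
    · apply DifferentiableAt.div <;> first | fun_prop | simp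
    · simp
  have h1 : g =O[𝓝 0] fun t => t := by
    have := hg.hasDerivAt.isBigO_sub
    simpa [g] using this
  exact (h1.comp_tendsto h_tendsto_zero).trans h_isBigO

theorem inv_hNum_isBigO (τ : ℂ) : (fun x => (hNum τ x)⁻¹) =O[cobounded ℂ] fun _ => (1 : ℂ) := by
  have h1 : Tendsto (fun x => (1 + (expNu τ - 1) * h x)⁻¹) (cobounded ℂ)
      (𝓝 (1 + (expNu τ - 1) * 0)⁻¹) :=
    ((h_tendsto_zero.const_mul _).const_add 1).inv₀ (by simp)
  exact h1.isBigO_one ℂ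

theorem hNum_tendsto_one (τ : ℂ) : Tendsto (hNum τ) (cobounded ℂ) (𝓝 1) := by
  have h1 := (h_tendsto_zero.const_mul (expNu τ - 1)).const_add 1
  rw [mul_zero, add_zero] at h1
  exact h1

/-- The exponential of `Ψ_μ(x, y, w) - 𝔥̂_τ(x) - 𝔥̂_τ(y)`, from which the square roots have
cancelled. -/
def defect (τ x y w : ℂ) : ℂ := (1 + (expNu τ - 1) * (w / (x * y))) / (hNum τ x * hNum τ y)

theorem exp_Psi {τ x y z w : ℂ} (hx : x ≠ 0) (hy : y ≠ 0) (hxμ : x ^ 2 ≠ τ + 2)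
    (hyμ : y ^ 2 ≠ τ + 2) (hv : x ^ 2 + y ^ 2 + z ^ 2 - x * y * z = τ + 2)
    (he : x * y = z + w) :
    Complex.exp (Psi (τ + 2) x y w) =
      Complex.exp (hatFrakH τ x) * Complex.exp (hatFrakH τ y) * defect τ x y w := by
  have hν : arcosh (1 - (τ + 2) / 2) = nu τ := by unfold nu; congr 1; ring
  have hE := expNu_sub_one_sq τ
  have hnum : (1 + (expNu τ - 1) * (w / (x * y))) ≠ 0 := by
    refine left_ne_zero_of_mul (b := 1 + (expNu τ - 1) * (1 - w / (x * y))) ?_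
    have : (1 + (expNu τ - 1) * (w / (x * y))) * (1 + (expNu τ - 1) * (1 - w / (x * y))) =
        expNu τ * ((1 - (τ + 2) / x ^ 2) * (1 - (τ + 2) / y ^ 2)) := by
      have hw : w = x * y - z := by rw [he]; ring
      have e1 : (1 + (expNu τ - 1) * (w / (x * y))) * (1 + (expNu τ - 1) * (1 - w / (x * y))) =
        expNu τ + (expNu τ - 1) ^ 2 * (w / (x * y)) * (1 - w / (x * y)) := by ring
      rw [e1, hE, hw]
      field_simp
      rw [← hv]
      ring
    rw [this]
    exact mul_ne_zero (expNu_ne_zero τ) (mul_ne_zero (one_sub_div_sq_ne_zero hx hxμ)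
      (one_sub_div_sq_ne_zero hy hyμ))
  have s1 := complex_sqrt_ne_zero (one_sub_div_sq_ne_zero hx hxμ)
  have s2 := complex_sqrt_ne_zero (one_sub_div_sq_ne_zero hy hyμ)
  have n1 := hNum_ne_zero hx hxμ
  have n2 := hNum_ne_zero hy hyμ
  rw [exp_hatFrakH hx hxμ, exp_hatFrakH hy hyμ, Psi, hν]
  change Complex.exp (Complex.log ((1 + (expNu τ - 1) * (w / (x * y))) / _)) = _
  rw [Complex.exp_log (div_ne_zero hnum (mul_ne_zero s1 s2)), defect]
  field_simp

/-- The vertex relation at the tail `x, y, z` of an edge with head `x, y, w`. -/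
theorem defect_eq_mul {τ x y z w : ℂ} (hx : x ≠ 0) (hy : y ≠ 0) (hz : z ≠ 0)
    (hzμ : z ^ 2 ≠ τ + 2)
    (hv : x ^ 2 + y ^ 2 + z ^ 2 - x * y * z = τ + 2) (he : x * y = z + w) :
    defect τ x y w = Complex.exp (frakH τ z) * (defect τ x z y * defect τ z y x) := by
  rw [exp_frakH hz hzμ]
  have hE := expNu_sub_one_sq τ
  have key : (1 + (expNu τ - 1) * (w / (x * y))) * (hNum τ z * hDen τ z) =
      (1 + (expNu τ - 1) * (y / (x * z))) * (1 + (expNu τ - 1) * (x / (z * y))) := by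
    have e1 : (1 + (expNu τ - 1) * (y / (x * z))) * (1 + (expNu τ - 1) * (x / (z * y))) =
        1 + (expNu τ - 1) * (y / (x * z) + x / (z * y)) +
          (expNu τ - 1) ^ 2 * ((y / (x * z)) * (x / (z * y))) := by ring
    have hw : w = x * y - z := by rw [he]; ring
    rw [hNum_mul_hDen τ z, e1, hE, hw, ← hv]
    field_simp
    ring
  have n3 := hNum_ne_zero hz hzμ
  have n4 := hDen_ne_zero hz hzμ
  have : (1 + (expNu τ - 1) * (w / (x * y))) =
      (1 + (expNu τ - 1) * (y / (x * z))) * (1 + (expNu τ - 1) * (x / (z * y))) /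
        (hNum τ z * hDen τ z) := by
    rw [← key, mul_div_cancel_right₀ _ (mul_ne_zero n3 n4)]
  unfold defect
  rw [this]
  simp only [div_eq_mul_inv, mul_inv]
  field_simp

/-- For a large edge the defect is close to `1`: `w / (x y)` differs from `h x + h y` by a multiple of
`h x * h y`, as long as the other root of the equation for `w / (x y)`, approximated by
`1 - h x - h y`, stays away from it. -/
theorem norm_defect_sub_one_le {τ x y w : ℂ} {K η : ℝ} (hη : 0 < η) (hx : 2 ≤ ‖x‖) (hy : 2 ≤ ‖y‖)
    (hxμ : x ^ 2 ≠ τ + 2) (hyμ : y ^ 2 ≠ τ + 2)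
    (hv : x ^ 2 + y ^ 2 + w ^ 2 - x * y * w = τ + 2)
    (hKx : ‖(hNum τ x)⁻¹‖ ≤ K) (hKy : ‖(hNum τ y)⁻¹‖ ≤ K)
    (hsep : η ≤ ‖1 - h x - h y - w / (x * y)‖) :
    ‖defect τ x y w - 1‖ ≤ K ^ 2 * ‖expNu τ - 1‖ * ((2 + 4 * ‖τ + 2‖) / η + ‖expNu τ - 1‖) *
      (‖h x‖ * ‖h y‖) := by
  have hx0 : x ≠ 0 := by rintro rfl; simp at hx; linarith
  have hy0 : y ≠ 0 := by rintro rfl; simp at hy; linarith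
  have n1 := hNum_ne_zero hx0 hxμ
  have n2 := hNum_ne_zero hy0 hyμ
  have hu := h_mul_one_sub_h x
  have hu' := h_mul_one_sub_h y
  set c := w / (x * y) with hc
  -- `c` solves a quadratic equation that is a perturbation of those for `h x` and `h y`.
  have hcc : c * (1 - c) = 1 / x ^ 2 + 1 / y ^ 2 - (τ + 2) * (1 / x ^ 2 * (1 / y ^ 2)) := by
    rw [hc, ← hv]
    field_simp
    ring
  have hd : (c - h x - h y) * (1 - h x - h y - c) =
      h x * h y * (2 - (τ + 2) * ((1 - h x) * (1 - h y))) := by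
    rw [← hu, ← hu'] at hcc
    linear_combination hcc
  have b1 : ∀ z : ℂ, 2 ≤ ‖z‖ → ‖1 - h z‖ ≤ 2 := fun z hz => by
    have h1 := norm_h_le_two_div_sq hz
    have h2 : 2 / ‖z‖ ^ 2 ≤ 1 := by
      rw [div_le_one (by positivity)]; nlinarith
    have := norm_sub_le 1 (h z)
    rw [norm_one] at this
    linarith
  have hd' : ‖c - h x - h y‖ ≤ (2 + 4 * ‖τ + 2‖) / η * (‖h x‖ * ‖h y‖) := by
    have h1 := congrArg norm hd
    rw [norm_mul, norm_mul, norm_mul] at h1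
    have h2 : ‖2 - (τ + 2) * ((1 - h x) * (1 - h y))‖ ≤ 2 + 4 * ‖τ + 2‖ := by
      refine (norm_sub_le _ _).trans ?_
      rw [norm_mul, norm_mul]
      have h3 : ‖1 - h x‖ * ‖1 - h y‖ ≤ 2 * 2 :=
        mul_le_mul (b1 x hx) (b1 y hy) (norm_nonneg _) (by norm_num)
      have h4 := mul_le_mul_of_nonneg_left h3 (norm_nonneg (τ + 2))
      simp only [Complex.norm_ofNat]
      linarith
    have h3 : ‖c - h x - h y‖ * η ≤ ‖h x‖ * ‖h y‖ * (2 + 4 * ‖τ + 2‖) :=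
      (mul_le_mul_of_nonneg_left hsep (norm_nonneg _)).trans
        (h1.le.trans (mul_le_mul_of_nonneg_left h2 (by positivity)))
    rw [← le_div_iff₀ hη] at h3
    exact h3.trans (le_of_eq (by ring))
  have hK : 0 ≤ K := (norm_nonneg _).trans hKx
  have hdef : defect τ x y w - 1 = (hNum τ x)⁻¹ * (hNum τ y)⁻¹ *
      ((expNu τ - 1) * ((c - h x - h y) - (expNu τ - 1) * (h x * h y))) := by
    have e1 : (expNu τ - 1) * ((c - h x - h y) - (expNu τ - 1) * (h x * h y)) =
        1 + (expNu τ - 1) * c - hNum τ x * hNum τ y := by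
      unfold hNum; ring
    rw [e1, defect, ← hc]
    field_simp
  rw [hdef, norm_mul, norm_mul, norm_mul]
  have h5 : ‖(c - h x - h y) - (expNu τ - 1) * (h x * h y)‖ ≤
      ((2 + 4 * ‖τ + 2‖) / η + ‖expNu τ - 1‖) * (‖h x‖ * ‖h y‖) := by
    refine (norm_sub_le _ _).trans ?_
    rw [norm_mul, norm_mul (h x)]
    linarith
  calc _ ≤ (K * K) * (‖expNu τ - 1‖ *
        (((2 + 4 * ‖τ + 2‖) / η + ‖expNu τ - 1‖) * (‖h x‖ * ‖h y‖))) := by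
        gcongr
    _ = _ := by ring

/-- The separation needed for `norm_defect_sub_one_le`.  It is positive for large `R`, because
`1 / (m - 1) < 1`. -/
theorem le_norm_one_sub_h_sub_h_sub {x y w : ℂ} {m R : ℝ} (hm : 2 < m) (hR : 2 ≤ R)
    (hx : m ≤ ‖x‖) (hy : m ≤ ‖y‖) (hw : ‖w‖ ≤ max ‖x‖ ‖y‖) (hmax : R ≤ max ‖x‖ ‖y‖) :
    1 - 1 / (m - 1) - 1 / (R * (R - 1)) ≤ ‖1 - h x - h y - w / (x * y)‖ := by
  wlog hxy : ‖x‖ ≤ ‖y‖ generalizing x y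
  · have := this hy hx (by rwa [max_comm]) (by rwa [max_comm]) (le_of_not_ge hxy)
    rwa [mul_comm x y, sub_right_comm 1 (h x) (h y)]
  rw [max_eq_right hxy] at hw hmax
  have h1 : ‖h x‖ ≤ 1 / (m * (m - 1)) := by
    refine (norm_h_le (by linarith)).trans ?_
    apply one_div_le_one_div_of_le
    · exact mul_pos (by linarith) (by linarith)
    · exact mul_le_mul hx (by linarith) (by linarith) (by linarith)
  have h2 : ‖h y‖ ≤ 1 / (R * (R - 1)) := by
    refine (norm_h_le (by linarith)).trans ?_
    apply one_div_le_one_div_of_le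
    · exact mul_pos (by linarith) (by linarith)
    · exact mul_le_mul hmax (by linarith) (by linarith) (by linarith)
  have h3 : ‖w / (x * y)‖ ≤ 1 / m := by
    rw [norm_div, norm_mul, div_le_div_iff₀ (mul_pos (by linarith) (by linarith)) (by linarith)]
    nlinarith [norm_nonneg w]
  have h4 : 1 / (m * (m - 1)) + 1 / m = 1 / (m - 1) := by
    have : m - 1 ≠ 0 := by linarith
    have : m ≠ 0 := by linarith
    field_simp
    ring
  have t1 := norm_sub_norm_le (1 - h x - h y) (w / (x * y))
  have t2 := norm_sub_norm_le (1 - h x) (h y)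
  have t3 := norm_sub_norm_le 1 (h x)
  rw [norm_one] at t3
  linarith

/-! ### Markoff functions on `ℤ²` and the Stern-Brocot decomposition -/

/-- The determinant of two vectors of `ℤ²`. -/
def det (u v : ℤ × ℤ) : ℤ := u.1 * v.2 - u.2 * v.1

/-- A `μ`-Markoff map written as an even function on `ℤ²`; only its values at primitive vectors
matter.  The regions at the two ends of the edge `u, v` are `u + v` and `u - v`. -/
structure IsMarkoffFun (μ : ℂ) (F : ℤ × ℤ → ℂ) : Prop where
  neg : ∀ u, F (-u) = F u
  vertex : ∀ u v, |det u v| = 1 → F u ^ 2 + F v ^ 2 + F (u + v) ^ 2 - F u * F v * F (u + v) = μ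
  edge : ∀ u v, |det u v| = 1 → F u * F v = F (u + v) + F (u - v)

/-- The primitive vectors with positive coordinates, which index `Ω⁻`. -/
def openCone : Set (ℕ × ℕ) := {p | 0 < p.1 ∧ 0 < p.2 ∧ p.1.Coprime p.2}

/-- The primitive vectors with nonnegative coordinates other than `(1, 0)`. -/
def halfCone : Set (ℤ × ℤ) := {p | IsCoprime p.1 p.2 ∧ 0 ≤ p.1 ∧ 0 < p.2}

/-- The vector with coordinates `p` with respect to `u`, `v`. -/
def comb (u v : ℤ × ℤ) (p : ℕ × ℕ) : ℤ × ℤ := (p.1 * u.1 + p.2 * v.1, p.1 * u.2 + p.2 * v.2)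

theorem comb_one_one (u v : ℤ × ℤ) : comb u v (1, 1) = u + v := by
  ext <;> simp [comb]

theorem comb_add_left (u v : ℤ × ℤ) (a b : ℕ) : comb u v (a + b, b) = comb u (u + v) (a, b) := by
  ext <;> simp [comb] <;> ring

theorem comb_add_right (u v : ℤ × ℤ) (a b : ℕ) : comb u v (a, a + b) = comb (u + v) v (a, b) := by
  ext <;> simp [comb] <;> ring

theorem det_add_right (u v : ℤ × ℤ) : det u (u + v) = det u v := by
  simp [det]; ring

theorem det_add_left (u v : ℤ × ℤ) : det (u + v) v = det u v := by
  simp [det]; ring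

theorem det_comb_right (u v : ℤ × ℤ) (p : ℕ × ℕ) : det (comb u v p) v = p.1 * det u v := by
  simp [det, comb]; ring

theorem det_comb_left (u v : ℤ × ℤ) (p : ℕ × ℕ) : det u (comb u v p) = p.2 * det u v := by
  simp [det, comb]; ring

theorem isCoprime_of_det {u v : ℤ × ℤ} (huv : |det u v| = 1) : IsCoprime u.1 u.2 := by
  have hs : det u v * det u v = 1 := by rw [← abs_mul_abs_self, huv, one_mul]
  have hd : det u v = u.1 * v.2 - u.2 * v.1 := rfl
  exact ⟨det u v * v.2, -(det u v * v.1), by linear_combination hs - det u v * hd⟩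

theorem isCoprime_comb {u v : ℤ × ℤ} (huv : |det u v| = 1) {p : ℕ × ℕ} (hp : p.1.Coprime p.2) :
    IsCoprime (comb u v p).1 (comb u v p).2 := by
  have hs : det u v * det u v = 1 := by rw [← abs_mul_abs_self, huv, one_mul]
  obtain ⟨s, t, hst⟩ := Nat.isCoprime_iff_coprime.2 hp
  refine ⟨det u v * (s * v.2 - t * u.2), det u v * (t * u.1 - s * v.1), ?_⟩
  have hd : det u v = u.1 * v.2 - u.2 * v.1 := rfl
  simp only [comb]
  linear_combination hs + hst * (det u v * det u v)  - det u v * (s * p.1 + t * p.2) * hd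

theorem comb_injective {u v : ℤ × ℤ} (huv : |det u v| = 1) : Function.Injective (comb u v) := by
  intro p q hpq
  have h0 : det u v ≠ 0 := by intro h0; simp [h0] at huv
  have h1 := det_comb_right u v p
  have h2 := det_comb_left u v p
  rw [hpq, det_comb_right] at h1
  rw [hpq, det_comb_left] at h2
  have h3 := mul_right_cancel₀ h0 h1
  have h4 := mul_right_cancel₀ h0 h2
  ext <;> [exact_mod_cast h3.symm; exact_mod_cast h4.symm]

theorem add_left_mem_openCone {p : ℕ × ℕ} (hp : p ∈ openCone) : (p.1 + p.2, p.2) ∈ openCone := by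
  obtain ⟨h1, h2, h3⟩ := hp
  exact ⟨by simp; omega, h2, by simpa using h3⟩

theorem add_right_mem_openCone {p : ℕ × ℕ} (hp : p ∈ openCone) :
    (p.1, p.1 + p.2) ∈ openCone := by
  obtain ⟨h1, h2, h3⟩ := hp
  exact ⟨h1, by simp; omega, by simpa using h3⟩

/-- Induction along the Stern-Brocot tree. -/
theorem openCone_induction {P : ℕ × ℕ → Prop} (one : P (1, 1))
    (left : ∀ p ∈ openCone, P p → P (p.1 + p.2, p.2))
    (right : ∀ p ∈ openCone, P p → P (p.1, p.1 + p.2)) : ∀ p ∈ openCone, P p := by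
  suffices ∀ n : ℕ, ∀ p ∈ openCone, p.1 + p.2 ≤ n → P p from fun p hp => this _ p hp le_rfl
  intro n
  induction n with
  | zero => rintro p ⟨h1, -, -⟩ hn; omega
  | succ n ih =>
    rintro ⟨a, b⟩ ⟨h1, h2, h3⟩ hn
    simp only at h1 h2 h3 hn
    rcases lt_trichotomy a b with hab | rfl | hab
    · obtain ⟨c, rfl⟩ := Nat.exists_eq_add_of_lt hab
      have hc : (a, c + 1) ∈ openCone := ⟨h1, by simp, by
        rw [add_assoc] at h3; simpa using h3⟩
      exact right (a, c + 1) hc (ih _ hc (by simp; omega))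
    · have : a = 1 := by simpa using h3
      subst this; exact one
    · obtain ⟨c, rfl⟩ := Nat.exists_eq_add_of_lt hab
      have hc : (c + 1, b) ∈ openCone := ⟨by simp, h2, by
        rw [add_assoc] at h3; simpa using h3⟩
      have := left (c + 1, b) hc (ih _ hc (by simp; omega))
      rwa [show b + c + 1 = c + 1 + b by ring]

theorem openCone_eq : openCone = {(1, 1)} ∪ ((fun p : ℕ × ℕ => (p.1 + p.2, p.2)) '' openCone ∪
    (fun p : ℕ × ℕ => (p.1, p.1 + p.2)) '' openCone) := by
  apply Set.Subset.antisymm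
  · exact openCone_induction (Or.inl rfl) (fun p hp _ => Or.inr (Or.inl ⟨p, hp, rfl⟩))
      (fun p hp _ => Or.inr (Or.inr ⟨p, hp, rfl⟩))
  · rintro p (rfl | ⟨q, hq, rfl⟩ | ⟨q, hq, rfl⟩)
    · exact ⟨one_pos, one_pos, Nat.coprime_one_left 1⟩
    · exact add_left_mem_openCone hq
    · exact add_right_mem_openCone hq

/-- The total of `g` over the regions behind the edge `u, v`, as seen from `u - v`. -/
def coneSum (g : ℤ × ℤ → ℂ) (u v : ℤ × ℤ) : ℂ := ∑' p : openCone, g (comb u v p)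

theorem add_left_injective_cone :
    Function.Injective (fun p : ℕ × ℕ => (p.1 + p.2, p.2)) := by
  intro p q hpq
  simp only [Prod.mk.injEq] at hpq
  ext <;> omega

theorem add_right_injective_cone :
    Function.Injective (fun p : ℕ × ℕ => (p.1, p.1 + p.2)) := by
  intro p q hpq
  simp only [Prod.mk.injEq] at hpq
  ext <;> omega

theorem disjoint_image_openCone :
    Disjoint ((fun p : ℕ × ℕ => (p.1 + p.2, p.2)) '' openCone)
      ((fun p : ℕ × ℕ => (p.1, p.1 + p.2)) '' openCone) := by
  rw [Set.disjoint_left]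
  rintro r ⟨p, hp, hpr⟩ ⟨q, hq, hqr⟩
  have h1 := congrArg Prod.fst (hpr.trans hqr.symm)
  have h2 := congrArg Prod.snd (hpr.trans hqr.symm)
  simp only at h1 h2
  have h3 := hp.1
  have h4 := hq.2.1
  omega

theorem disjoint_singleton_image_openCone :
    Disjoint {((1 : ℕ), (1 : ℕ))} ((fun p : ℕ × ℕ => (p.1 + p.2, p.2)) '' openCone ∪
      (fun p : ℕ × ℕ => (p.1, p.1 + p.2)) '' openCone) := by
  rw [Set.disjoint_singleton_left]
  rintro (⟨p, hp, hpr⟩ | ⟨p, hp, hpr⟩) <;>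
  · have h1 := congrArg Prod.fst hpr
    have h2 := congrArg Prod.snd hpr
    simp only at h1 h2
    have h3 := hp.1
    have h4 := hp.2.1
    omega

theorem tsum_openCone {G : ℕ × ℕ → ℂ} (hs : Summable fun p : openCone => G p) :
    ∑' p : openCone, G p = G (1, 1) +
      (∑' p : openCone, G (p.1.1 + p.1.2, p.1.2) + ∑' p : openCone, G (p.1.1, p.1.1 + p.1.2)) := by
  have hsub : ∀ s ⊆ openCone, Summable (G ∘ ((↑) : s → ℕ × ℕ)) := fun s hss =>
    hs.comp_injective (Set.inclusion_injective hss)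
  have hss := openCone_eq.symm.subset
  rw [tsum_congr_set_coe G openCone_eq,
    Summable.tsum_union_disjoint disjoint_singleton_image_openCone
      (hsub _ (Set.subset_union_left.trans hss)) (hsub _ (Set.subset_union_right.trans hss)),
    Summable.tsum_union_disjoint disjoint_image_openCone
      (hsub _ ((Set.subset_union_left.trans Set.subset_union_right).trans hss))
      (hsub _ ((Set.subset_union_right.trans Set.subset_union_right).trans hss)),
    tsum_image G add_left_injective_cone.injOn, tsum_image G add_right_injective_cone.injOn,
    tsum_singleton (1, 1) G]

/-- The Stern-Brocot decomposition of the cone of `u` and `v` by the ray through `u + v`. -/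
theorem coneSum_eq_add {g : ℤ × ℤ → ℂ} {u v : ℤ × ℤ}
    (hs : Summable fun p : openCone => g (comb u v p)) :
    coneSum g u v = g (u + v) + (coneSum g u (u + v) + coneSum g (u + v) v) := by
  have e0 := tsum_openCone (G := fun p => g (comb u v p)) hs
  simp only [comb_one_one, comb_add_left, comb_add_right] at e0
  exact e0

/-! ### Growth and summability -/

/-- The inverse square of `(1 - 1 / m) ‖z‖`.  With this normalisation the weight is
submultiplicative along the tree: see `GoodEdge.weight_add_le`. -/
def weight (m : ℝ) (z : ℂ) : ℝ := (((1 - 1 / m) * ‖z‖)⁻¹) ^ 2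

theorem one_sub_inv_pos {m : ℝ} (hm : 2 < m) : 0 < 1 - 1 / m := by
  rw [sub_pos, div_lt_one (by linarith)]; linarith

theorem sub_one_le_mul_norm {m : ℝ} (hm : 2 < m) {z : ℂ} (hz : m ≤ ‖z‖) :
    m - 1 ≤ (1 - 1 / m) * ‖z‖ := by
  have h1 := mul_le_mul_of_nonneg_left hz (one_sub_inv_pos hm).le
  have h2 : (1 - 1 / m) * m = m - 1 := by
    have : m ≠ 0 := by linarith
    field_simp
  linarith

theorem weight_pos {m : ℝ} (hm : 2 < m) {z : ℂ} (hz : m ≤ ‖z‖) : 0 < weight m z :=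
  pow_pos (inv_pos.2 (by linarith [sub_one_le_mul_norm hm hz])) 2

theorem weight_nonneg (m : ℝ) (z : ℂ) : 0 ≤ weight m z := sq_nonneg _

theorem weight_le {m : ℝ} (hm : 2 < m) {z : ℂ} (hz : m ≤ ‖z‖) :
    weight m z ≤ ((m - 1)⁻¹) ^ 2 := by
  have h1 := sub_one_le_mul_norm hm hz
  have h2 : 0 < m - 1 := by linarith
  have h3 : 0 < (1 - 1 / m) * ‖z‖ := by linarith
  unfold weight
  gcongr

theorem inv_sub_one_sq_lt_one {m : ℝ} (hm : 2 < m) : ((m - 1)⁻¹) ^ 2 < 1 :=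
  pow_lt_one₀ (inv_nonneg.2 (by linarith)) (inv_lt_one_of_one_lt₀ (by linarith)) two_ne_zero

theorem inv_norm_sq_le_weight {m : ℝ} (hm : 2 < m) (z : ℂ) : 1 / ‖z‖ ^ 2 ≤ weight m z := by
  have h0 := one_sub_inv_pos hm
  have h1 : 1 - 1 / m ≤ 1 := by
    have : 0 < 1 / m := one_div_pos.2 (by linarith)
    linarith
  rcases (norm_nonneg z).eq_or_lt with hz | hz
  · rw [← hz]; simpa using weight_nonneg m z
  unfold weight
  rw [one_div, ← inv_pow]
  gcongr
  nlinarith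

theorem weight_eq (m : ℝ) (z : ℂ) : weight m z = ((1 - 1 / m)⁻¹) ^ 2 * (1 / ‖z‖ ^ 2) := by
  unfold weight
  rw [mul_inv, mul_pow, inv_pow ‖z‖, one_div (‖z‖ ^ 2)]

/-- An edge `u, v` of the tree with values of modulus at least `m` on its two sides, whose end on
the region `u - v` does not carry the largest value around it. -/
structure GoodEdge (F : ℤ × ℤ → ℂ) (m : ℝ) (u v : ℤ × ℤ) : Prop where
  left_mem : u ∈ halfCone
  right_mem : v ∈ halfCone
  det_eq : |det u v| = 1
  left : m ≤ ‖F u‖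
  right : m ≤ ‖F v‖
  opp : ‖F (u - v)‖ ≤ max ‖F u‖ ‖F v‖

theorem add_mem_halfCone {u v : ℤ × ℤ} (hu : u ∈ halfCone) (hv : v ∈ halfCone)
    (huv : |det u v| = 1) : u + v ∈ halfCone := by
  refine ⟨isCoprime_of_det (v := v) (by rwa [det_add_left]), ?_, ?_⟩
  · exact add_nonneg hu.2.1 hv.2.1
  · exact add_pos hu.2.2 hv.2.2

namespace GoodEdge

variable {μ : ℂ} {F : ℤ × ℤ → ℂ} {m : ℝ} {u v : ℤ × ℤ}

theorem mul_norm_le (hF : IsMarkoffFun μ F) (hm : 2 < m) (h : GoodEdge F m u v) :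
    (1 - 1 / m) * (‖F u‖ * ‖F v‖) ≤ ‖F (u + v)‖ := by
  have h1 : ‖F u‖ * ‖F v‖ ≤ ‖F (u + v)‖ + ‖F (u - v)‖ := by
    rw [← norm_mul, hF.edge u v h.det_eq]; exact norm_add_le _ _
  have h2 : max ‖F u‖ ‖F v‖ ≤ 1 / m * (‖F u‖ * ‖F v‖) := by
    have hl := h.left
    have hr := h.right
    rw [div_mul_eq_mul_div, one_mul, le_div_iff₀ (by linarith)]
    rcases max_cases ‖F u‖ ‖F v‖ with ⟨h, -⟩ | ⟨h, -⟩ <;> rw [h] <;> nlinarith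
  linarith [h.opp]

theorem max_le (hF : IsMarkoffFun μ F) (hm : 2 < m) (h : GoodEdge F m u v) :
    max ‖F u‖ ‖F v‖ ≤ ‖F (u + v)‖ := by
  have h1 := h.mul_norm_le hF hm
  have h2 := sub_one_le_mul_norm hm h.left
  have h3 := sub_one_le_mul_norm hm h.right
  have hl := h.left
  have hr := h.right
  apply _root_.max_le <;> nlinarith

theorem le_add (hF : IsMarkoffFun μ F) (hm : 2 < m) (h : GoodEdge F m u v) :
    m ≤ ‖F (u + v)‖ :=
  (h.left.trans (le_max_left _ _)).trans (h.max_le hF hm)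

theorem weight_add_le (hF : IsMarkoffFun μ F) (hm : 2 < m) (h : GoodEdge F m u v) :
    weight m (F (u + v)) ≤ weight m (F u) * weight m (F v) := by
  have h0 := one_sub_inv_pos hm
  have h1 := mul_le_mul_of_nonneg_left (h.mul_norm_le hF hm) h0.le
  have hl : 0 < ‖F u‖ := by linarith [h.left]
  have hr : 0 < ‖F v‖ := by linarith [h.right]
  unfold weight
  rw [← mul_pow, ← mul_inv]
  refine pow_le_pow_left₀ (by positivity) (inv_anti₀ (by positivity) ?_) 2
  linarith

theorem left_child (hF : IsMarkoffFun μ F) (hm : 2 < m) (h : GoodEdge F m u v) :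
    GoodEdge F m u (u + v) where
  left_mem := h.left_mem
  right_mem := add_mem_halfCone h.left_mem h.right_mem h.det_eq
  det_eq := by rw [det_add_right]; exact h.det_eq
  left := h.left
  right := h.le_add hF hm
  opp := by
    rw [show u - (u + v) = -v by abel, hF.neg]
    exact (le_max_right _ _).trans ((h.max_le hF hm).trans (le_max_right _ _))

theorem right_child (hF : IsMarkoffFun μ F) (hm : 2 < m) (h : GoodEdge F m u v) :
    GoodEdge F m (u + v) v where
  left_mem := add_mem_halfCone h.left_mem h.right_mem h.det_eq
  right_mem := h.right_mem
  det_eq := by rw [det_add_left]; exact h.det_eq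
  left := h.le_add hF hm
  right := h.right
  opp := by
    rw [show u + v - v = u by abel]
    exact (le_max_left _ _).trans ((h.max_le hF hm).trans (le_max_left _ _))

/-- Exponential growth: the normalised modulus at `a u + b v` is at least the product of its `a`-th
power at `u` and its `b`-th power at `v`. -/
theorem growth (hF : IsMarkoffFun μ F) (hm : 2 < m) : ∀ p ∈ openCone, ∀ u v : ℤ × ℤ,
    GoodEdge F m u v → m ≤ ‖F (comb u v p)‖ ∧
      weight m (F (comb u v p)) ≤ weight m (F u) ^ p.1 * weight m (F v) ^ p.2 := by
  apply openCone_induction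
  · intro u v h
    rw [comb_one_one, pow_one, pow_one]
    exact ⟨h.le_add hF hm, h.weight_add_le hF hm⟩
  · intro p _ ih u v h
    rw [comb_add_left]
    obtain ⟨h1, h2⟩ := ih u (u + v) (h.left_child hF hm)
    refine ⟨h1, h2.trans ?_⟩
    rw [pow_add, mul_assoc, ← mul_pow]
    have := h.weight_add_le hF hm
    have := weight_nonneg m (F u)
    have := weight_nonneg m (F (u + v))
    gcongr
  · intro p _ ih u v h
    rw [comb_add_right]
    obtain ⟨h1, h2⟩ := ih (u + v) v (h.right_child hF hm)
    refine ⟨h1, h2.trans ?_⟩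
    rw [pow_add, ← mul_assoc, ← mul_pow]
    have := h.weight_add_le hF hm
    have := weight_nonneg m (F v)
    have := weight_nonneg m (F (u + v))
    gcongr

end GoodEdge

/-- A Markoff function with value `±2` at `(1, 0)` and modulus at least `m > 2` at the neighbours
`(n, 1)`, `n ≥ 0`, of `(1, 0)`. -/
structure ParabolicCone (μ : ℂ) (F : ℤ × ℤ → ℂ) (m : ℝ) : Prop where
  markoff : IsMarkoffFun μ F
  parabolic : F (1, 0) = 2 ∨ F (1, 0) = -2
  two_lt : 2 < m
  le : ∀ n : ℕ, m ≤ ‖F (n, 1)‖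

theorem fan_mem_halfCone (n : ℕ) : ((n : ℤ), (1 : ℤ)) ∈ halfCone :=
  ⟨isCoprime_one_right, by simp, one_pos⟩

/-- Division with remainder of the first coordinate by the second puts a vector of the half cone into
the cone spanned by consecutive neighbours `(q + 1, 1)`, `(q, 1)` of `(1, 0)`. -/
theorem halfCone_cases {p : ℤ × ℤ} (hp : p ∈ halfCone) : ∃ q r s : ℕ,
    p = comb ((q : ℤ) + 1, 1) (q, 1) (r, s + 1) ∧ (r = 0 ∧ s = 0 ∨ (r, s + 1) ∈ openCone) := by
  obtain ⟨a, b⟩ := p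
  obtain ⟨hc, ha, hb⟩ := hp
  simp only at hc ha hb
  have hr0 := Int.emod_nonneg a hb.ne'
  have hr1 := Int.emod_lt_of_pos a hb
  have hq0 := Int.ediv_nonneg ha hb.le
  have hqr := Int.mul_ediv_add_emod a b
  obtain ⟨q, hq⟩ := Int.eq_ofNat_of_zero_le hq0
  obtain ⟨r, hr⟩ := Int.eq_ofNat_of_zero_le hr0
  obtain ⟨s, hs⟩ := Int.eq_ofNat_of_zero_le (show 0 ≤ b - 1 - a % b by omega)
  rw [hq, hr] at hqr
  rw [hr] at hs hr1
  have hbs : b = r + s + 1 := by linarith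
  have hcr : IsCoprime (r : ℤ) b := by
    rw [← hqr] at hc
    exact (IsCoprime.mul_add_left_left_iff (z := (q : ℤ))).1 hc
  refine ⟨q, r, s, ?_, ?_⟩
  · ext
    · simp only [comb]; push_cast; rw [← hqr, hbs]; ring
    · simp only [comb]; push_cast; rw [hbs]; ring
  · rcases Nat.eq_zero_or_pos r with h0 | h0
    · left
      refine ⟨h0, ?_⟩
      rw [h0] at hcr
      have := Int.isUnit_iff.1 (isCoprime_zero_left.1 (by simpa using hcr))
      omega
    · right
      refine ⟨h0, Nat.succ_pos s, ?_⟩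
      rw [← Nat.isCoprime_iff_coprime]
      rw [show b = ((s + 1 : ℕ) : ℤ) + (r : ℤ) * 1 by push_cast; linarith] at hcr
      exact IsCoprime.add_mul_left_right_iff.1 hcr

namespace ParabolicCone

variable {μ : ℂ} {F : ℤ × ℤ → ℂ} {m : ℝ}

theorem norm_eq_two (h : ParabolicCone μ F m) : ‖F (1, 0)‖ = 2 := by
  rcases h.parabolic with h | h <;> rw [h] <;> simp

/-- The edge between consecutive neighbours of `(1, 0)`, with one end on `(1, 0)` itself. -/
theorem goodEdge (h : ParabolicCone μ F m) (n : ℕ) :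
    GoodEdge F m ((n : ℤ) + 1, 1) ((n : ℤ), 1) where
  left_mem := by exact_mod_cast fan_mem_halfCone (n + 1)
  right_mem := fan_mem_halfCone n
  det_eq := by simp [det]
  left := by exact_mod_cast h.le (n + 1)
  right := h.le n
  opp := by
    rw [show ((n : ℤ) + 1, (1 : ℤ)) - ((n : ℤ), 1) = (1, 0) by ext <;> simp, h.norm_eq_two]
    exact (h.two_lt.le.trans (h.le n)).trans (le_max_right _ _)

theorem le_norm (h : ParabolicCone μ F m) {p : ℤ × ℤ} (hp : p ∈ halfCone) : m ≤ ‖F p‖ := by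
  obtain ⟨q, r, s, rfl, ⟨rfl, rfl⟩ | hrs⟩ := halfCone_cases hp
  · simpa [comb] using h.le q
  · exact (GoodEdge.growth h.markoff h.two_lt _ hrs _ _ (h.goodEdge q)).1

end ParabolicCone

/-- Along the boundary of a region with value `±2` a Markoff function is, up to signs, an
arithmetic progression. -/
theorem IsMarkoffFun.fan_eq {μ : ℂ} {F : ℤ × ℤ → ℂ} (hF : IsMarkoffFun μ F)
    (h2 : F (1, 0) = 2 ∨ F (1, 0) = -2) :
    ∃ σ δ : ℂ, σ ^ 2 = 1 ∧ F (1, 0) = 2 * σ ∧ δ ^ 2 = μ - 4 ∧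
      ∀ n : ℕ, F (n, 1) = σ ^ n * (F (0, 1) + n * δ) := by
  obtain ⟨σ, hσ, hσ2⟩ : ∃ σ : ℂ, σ ^ 2 = 1 ∧ F (1, 0) = 2 * σ := by
    rcases h2 with h2 | h2
    · exact ⟨1, by norm_num, by rw [h2]; norm_num⟩
    · exact ⟨-1, by norm_num, by rw [h2]; norm_num⟩
  refine ⟨σ, σ * F (1, 1) - F (0, 1), hσ, hσ2, ?_, ?_⟩
  · have := hF.vertex (1, 0) (0, 1) (by simp [det])
    simp only [Prod.mk_add_mk, add_zero, zero_add] at this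
    rw [hσ2] at this
    linear_combination this + (F (1, 1) ^ 2 - 4) * hσ
  · intro n
    induction n using Nat.twoStepInduction with
    | zero => simp
    | one => simp; linear_combination (-F (1, 1)) * hσ
    | more n ih1 ih2 =>
      have := hF.edge ((n : ℤ) + 1, 1) (1, 0) (by simp [det])
      simp only [Prod.mk_add_mk, Prod.mk_sub_mk, add_zero, sub_zero, add_sub_cancel_right] at this
      push_cast at ih2 ⊢
      rw [ih1, ih2, hσ2] at this
      rw [show (n : ℤ) + 2 = n + 1 + 1 by ring]
      linear_combination -this + σ ^ n * (F (0, 1) + n * (σ * F (1, 1) - F (0, 1))) * hσ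

theorem IsMarkoffFun.norm_fan_ge {μ : ℂ} {F : ℤ × ℤ → ℂ} (hF : IsMarkoffFun μ F) (hμ : μ ≠ 4)
    (h2 : F (1, 0) = 2 ∨ F (1, 0) = -2) :
    ∃ C > 0, ∀ᶠ n : ℕ in atTop, C * n ≤ ‖F (n, 1)‖ := by
  obtain ⟨σ, δ, hσ, -, hδ, hn⟩ := hF.fan_eq h2
  have hσ1 : ‖σ‖ = 1 := by
    have := congrArg norm hσ
    rw [norm_pow, norm_one] at this
    exact (pow_eq_one_iff_of_nonneg (norm_nonneg _) two_ne_zero).1 this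
  have hδ0 : 0 < ‖δ‖ := by
    rw [norm_pos_iff]
    rintro rfl
    exact hμ (by linear_combination -hδ)
  refine ⟨‖δ‖ / 2, by positivity, ?_⟩
  filter_upwards [(tendsto_natCast_atTop_atTop (R := ℝ)).eventually_ge_atTop
    (2 * ‖F (0, 1)‖ / ‖δ‖)] with n hn'
  rw [div_le_iff₀ hδ0] at hn'
  rw [hn n, norm_mul, norm_pow, hσ1, one_pow, one_mul]
  have := norm_sub_norm_le ((n : ℂ) * δ) (-F (0, 1))
  rw [norm_neg, sub_neg_eq_add, norm_mul, Complex.norm_natCast, add_comm ((n : ℂ) * δ)] at this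
  linarith

theorem IsMarkoffFun.tendsto_fan {μ : ℂ} {F : ℤ × ℤ → ℂ} (hF : IsMarkoffFun μ F) (hμ : μ ≠ 4)
    (h2 : F (1, 0) = 2 ∨ F (1, 0) = -2) :
    Tendsto (fun n : ℕ => F (n, 1)) atTop (cobounded ℂ) := by
  obtain ⟨C, hC, hn⟩ := hF.norm_fan_ge hμ h2
  rw [← tendsto_norm_atTop_iff_cobounded]
  exact tendsto_atTop_mono' _ hn
    ((tendsto_natCast_atTop_atTop (R := ℝ)).const_mul_atTop hC)

theorem IsMarkoffFun.exists_parabolicCone {μ : ℂ} {F : ℤ × ℤ → ℂ} (hF : IsMarkoffFun μ F)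
    (hμ : μ ≠ 4) (h2 : F (1, 0) = 2 ∨ F (1, 0) = -2) (hgt : ∀ n : ℕ, 2 < ‖F (n, 1)‖) :
    ∃ m, ParabolicCone μ F m := by
  have h1 := tendsto_norm_atTop_iff_cobounded.2 (hF.tendsto_fan hμ h2)
  obtain ⟨N, hN⟩ := eventually_atTop.1 (h1.eventually_ge_atTop 3)
  obtain ⟨k, -, hk⟩ := Finset.exists_min_image (Finset.range (N + 1)) (fun n : ℕ => ‖F (n, 1)‖)
    ⟨0, by simp⟩
  refine ⟨min 3 ‖F (k, 1)‖, hF, h2, lt_min (by norm_num) (hgt k), fun n => ?_⟩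
  rcases le_or_gt N n with h | h
  · exact (min_le_left _ _).trans (hN n h)
  · exact (min_le_right _ _).trans (hk n (by simp; omega))

namespace ParabolicCone

variable {μ : ℂ} {F : ℤ × ℤ → ℂ} {m : ℝ}

theorem summable_weight_fan (h : ParabolicCone μ F m) (hμ : μ ≠ 4) :
    Summable fun n : ℕ => weight m (F (n, 1)) := by
  obtain ⟨C, hC, hn⟩ := h.markoff.norm_fan_ge hμ h.parabolic
  refine summable_of_isBigO_nat (g := fun n : ℕ => 1 / (n : ℝ) ^ 2)
    (Real.summable_one_div_nat_pow.2 one_lt_two) ?_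
  refine IsBigO.of_bound (((1 - 1 / m)⁻¹) ^ 2 * (C⁻¹) ^ 2) ?_
  filter_upwards [hn, eventually_gt_atTop 0] with n hn hn0
  have hn0' : (0 : ℝ) < n := by exact_mod_cast hn0
  rw [Real.norm_of_nonneg (weight_nonneg _ _), Real.norm_of_nonneg (by positivity), weight_eq,
    mul_assoc]
  gcongr
  rw [one_div, one_div, ← inv_pow, ← inv_pow, ← mul_pow, ← mul_inv]
  gcongr

/-- The weights are dominated by a product of the summable weights of the vectors `(q, 1)` and two
geometric series. -/
theorem summable_weight (h : ParabolicCone μ F m) (hμ : μ ≠ 4) :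
    Summable fun p : halfCone => weight m (F p) := by
  have hm := h.two_lt
  set ρ := ((m - 1)⁻¹) ^ 2 with hρ
  have hρ0 : 0 ≤ ρ := sq_nonneg _
  have hgeo := summable_geometric_of_lt_one hρ0 (inv_sub_one_sq_lt_one hm)
  have hsum : Summable fun x : ℕ × ℕ × ℕ => weight m (F (x.1, 1)) * (ρ ^ x.2.1 * ρ ^ x.2.2) :=
    (h.summable_weight_fan hμ).mul_of_nonneg
      (hgeo.mul_of_nonneg hgeo (fun _ => pow_nonneg hρ0 _) (fun _ => pow_nonneg hρ0 _))
      (fun _ => weight_nonneg _ _) (fun _ => mul_nonneg (pow_nonneg hρ0 _) (pow_nonneg hρ0 _))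
  choose q r s hp hrs using fun p : halfCone => halfCone_cases p.2
  have hinj : Function.Injective fun p : halfCone => (q p, r p, s p) := by
    intro p p' hpp
    simp only [Prod.mk.injEq] at hpp
    apply Subtype.ext
    rw [hp p, hp p', hpp.1, hpp.2.1, hpp.2.2]
  refine Summable.of_nonneg_of_le (fun _ => weight_nonneg _ _) (fun p => ?_)
    (hsum.comp_injective hinj)
  rw [hp p]
  simp only [Function.comp_apply]
  rcases hrs p with ⟨h1, h2⟩ | h1
  · rw [h1, h2]
    simp [comb]
  · have hg := h.goodEdge (q p)
    refine (GoodEdge.growth h.markoff hm _ h1 _ _ hg).2.trans ?_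
    have w1 := weight_le hm hg.left
    have w2 := weight_le hm hg.right
    have w3 := weight_nonneg m (F ((q p : ℤ), 1))
    have w4 := weight_nonneg m (F ((q p : ℤ) + 1, 1))
    calc weight m (F ((q p : ℤ) + 1, 1)) ^ r p * weight m (F ((q p : ℤ), 1)) ^ (s p + 1)
        ≤ ρ ^ r p * (ρ ^ s p * weight m (F ((q p : ℤ), 1))) := by
          rw [pow_succ]
          gcongr
      _ = _ := by ring

end ParabolicCone

/-! ### Rigidity of multiplicative edge functions -/

/-- Label the sides of an edge by `a` and `b`, and let every region further down carry the product of
the labels of the two sides of the edge in front of it.  This is the sum, over the edges at depth `k`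
behind the first one, of the product of the labels of the two sides. -/
def depthSum : ℕ → ℝ → ℝ → ℝ
  | 0, a, b => a * b
  | k + 1, a, b => depthSum k a (a * b) + depthSum k (a * b) b

theorem depthSum_nonneg (k : ℕ) : ∀ a b : ℝ, 0 ≤ a → 0 ≤ b → 0 ≤ depthSum k a b := by
  induction k with
  | zero => intro a b ha hb; exact mul_nonneg ha hb
  | succ k ih =>
    intro a b ha hb
    exact add_nonneg (ih _ _ ha (mul_nonneg ha hb)) (ih _ _ (mul_nonneg ha hb) hb)

theorem depthSum_mono (k : ℕ) : ∀ a b a' b' : ℝ, 0 ≤ a → 0 ≤ b → a ≤ a' → b ≤ b' →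
    depthSum k a b ≤ depthSum k a' b' := by
  induction k with
  | zero => intro a b a' b' ha hb h1 h2; exact mul_le_mul h1 h2 hb (ha.trans h1)
  | succ k ih =>
    intro a b a' b' ha hb h1 h2
    have h3 : a * b ≤ a' * b' := mul_le_mul h1 h2 hb (ha.trans h1)
    exact add_le_add (ih _ _ _ _ ha (mul_nonneg ha hb) h1 h3)
      (ih _ _ _ _ (mul_nonneg ha hb) hb h3 h2)

theorem sum_depthSum_le (n : ℕ) : ∀ a b : ℝ, 0 ≤ a → a < 1 → 0 ≤ b → b < 1 →
    ∑ k ∈ Finset.range n, depthSum k a b ≤ a * b / ((1 - a) * (1 - b)) := by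
  induction n with
  | zero =>
    intro a b ha ha' hb hb'
    simpa using div_nonneg (mul_nonneg ha hb) (mul_nonneg (by linarith) (by linarith))
  | succ n ih =>
    intro a b ha ha' hb hb'
    have hab : 0 ≤ a * b := mul_nonneg ha hb
    have hab' : a * b < 1 := mul_lt_one_of_nonneg_of_lt_one_left ha ha' hb'.le
    rw [Finset.sum_range_succ']
    simp only [depthSum, Finset.sum_add_distrib]
    have h1 := ih a (a * b) ha ha' hab hab'
    have h2 := ih (a * b) b hab hab' hb hb'
    have p1 : 0 < 1 - a := by linarith
    have p2 : 0 < 1 - b := by linarith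
    have p3 : 0 < 1 - a * b := by linarith
    -- the lattice points `(i, j)`, `i, j ≥ 1`, split into `i > j`, `i < j` and `i = j`
    have h3 : a * b / ((1 - a) * (1 - b)) = a * (a * b) / ((1 - a) * (1 - a * b)) +
        a * b * b / ((1 - a * b) * (1 - b)) + a * b / (1 - a * b) := by
      field_simp
      ring
    have h4 : a * b ≤ a * b / (1 - a * b) := by
      rw [le_div_iff₀ p3]; nlinarith
    linarith

theorem tendsto_depthSum {a b : ℝ} (ha : 0 ≤ a) (ha' : a < 1) (hb : 0 ≤ b) (hb' : b < 1) :
    Tendsto (fun k => depthSum k a b) atTop (𝓝 0) :=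
  (summable_of_sum_range_le (fun k => depthSum_nonneg k a b ha hb)
    (fun n => sum_depthSum_le n a b ha ha' hb hb')).tendsto_atTop_zero

variable {μ τ : ℂ} {F : ℤ × ℤ → ℂ} {m : ℝ}

/-- An edge function that is multiplicative at the vertices of the tree and summably close to `1`
on good edges equals `1` there. -/
theorem eq_one_of_multiplicative (hF : IsMarkoffFun μ F) (hm : 2 < m)
    {Q : ℤ × ℤ → ℤ × ℤ → ℂ} {K : ℝ} (hK : 0 ≤ K)
    (hmul : ∀ u v, GoodEdge F m u v → Q u v = Q u (u + v) * Q (u + v) v)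
    (hbd : ∀ u v, GoodEdge F m u v → ‖Q u v - 1‖ ≤ K * (weight m (F u) * weight m (F v)))
    {u v : ℤ × ℤ} (h : GoodEdge F m u v) : Q u v = 1 := by
  have key : ∀ k : ℕ, ∀ u v, GoodEdge F m u v →
      ‖Q u v - 1‖ ≤ Real.exp (K * depthSum k (weight m (F u)) (weight m (F v))) - 1 := by
    intro k
    induction k with
    | zero =>
      intro u v h
      refine (hbd u v h).trans ?_
      have := Real.add_one_le_exp (K * (weight m (F u) * weight m (F v)))
      simp only [depthSum]
      linarith
    | succ k ih =>
      intro u v h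
      have h1 := ih _ _ (h.left_child hF hm)
      have h2 := ih _ _ (h.right_child hF hm)
      have w0 := h.weight_add_le hF hm
      have wu := weight_nonneg m (F u)
      have wv := weight_nonneg m (F v)
      have wz := weight_nonneg m (F (u + v))
      have e1 : Q u v - 1 = (Q u (u + v) - 1) * (Q (u + v) v - 1) + (Q u (u + v) - 1) +
          (Q (u + v) v - 1) := by rw [hmul u v h]; ring
      have e2 : ‖Q u v - 1‖ ≤ ‖Q u (u + v) - 1‖ * ‖Q (u + v) v - 1‖ + ‖Q u (u + v) - 1‖ +
          ‖Q (u + v) v - 1‖ := by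
        rw [e1, ← norm_mul]; exact norm_add₃_le
      set A := K * depthSum k (weight m (F u)) (weight m (F (u + v)))
      set B := K * depthSum k (weight m (F (u + v))) (weight m (F v))
      have e3 : ‖Q u (u + v) - 1‖ * ‖Q (u + v) v - 1‖ ≤ (Real.exp A - 1) * (Real.exp B - 1) :=
        mul_le_mul h1 h2 (norm_nonneg _) ((norm_nonneg _).trans h1)
      have e4 : A + B ≤ K * depthSum (k + 1) (weight m (F u)) (weight m (F v)) := by
        rw [← mul_add]
        refine mul_le_mul_of_nonneg_left (add_le_add ?_ ?_) hK
        · exact depthSum_mono k _ _ _ _ wu wz le_rfl w0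
        · exact depthSum_mono k _ _ _ _ wz wv w0 le_rfl
      have e5 := Real.exp_le_exp.2 e4
      rw [Real.exp_add] at e5
      nlinarith
  have ht : Tendsto (fun k : ℕ =>
      Real.exp (K * depthSum k (weight m (F u)) (weight m (F v))) - 1) atTop (𝓝 0) := by
    have hρ := inv_sub_one_sq_lt_one hm
    have h1 := (tendsto_depthSum (weight_nonneg m (F u)) ((weight_le hm h.left).trans_lt hρ)
      (weight_nonneg m (F v)) ((weight_le hm h.right).trans_lt hρ)).const_mul K
    have h2 := ((Real.continuous_exp.tendsto _).comp h1).sub_const 1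
    simpa using h2
  have h0 := ge_of_tendsto' ht fun k => key k u v h
  exact sub_eq_zero.1 (norm_le_zero_iff.1 h0)

/-- The summands of `Σ 𝔥_τ(φ(X))`, indexed by vectors. -/
def hTerm (τ : ℂ) (F : ℤ × ℤ → ℂ) (p : ℤ × ℤ) : ℂ := frakH τ (F p)

/-- The ratio of the two sides of the exponentiated identity for the edge `u, v`, directed towards
`u - v`. -/
def edgeRatio (τ : ℂ) (F : ℤ × ℤ → ℂ) (u v : ℤ × ℤ) : ℂ :=
  defect τ (F u) (F v) (F (u - v)) * Complex.exp (-coneSum (hTerm τ F) u v)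

theorem edgeRatio_eq_mul (hF : IsMarkoffFun (τ + 2) F) {u v : ℤ × ℤ} (huv : |det u v| = 1)
    (hu : F u ≠ 0) (hv : F v ≠ 0) (hz : F (u + v) ≠ 0) (hzμ : F (u + v) ^ 2 ≠ τ + 2)
    (hs : Summable fun p : openCone => hTerm τ F (comb u v p)) :
    edgeRatio τ F u v = edgeRatio τ F u (u + v) * edgeRatio τ F (u + v) v := by
  unfold edgeRatio
  rw [defect_eq_mul hu hv hz hzμ (hF.vertex u v huv) (hF.edge u v huv), coneSum_eq_add hs,
    show u - (u + v) = -v by abel, show u + v - v = u by abel, hF.neg, neg_add, neg_add,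
    Complex.exp_add, Complex.exp_add, hTerm]
  have := Complex.exp_ne_zero (frakH τ (F (u + v)))
  rw [Complex.exp_neg (frakH τ (F (u + v)))]
  field_simp

/-- A decreasing geometric progression is not bounded below by `2`. -/
theorem false_of_geometric {s : ℕ → ℝ} (h2 : ∀ n, 2 ≤ s n)
    (hs : ∀ n, s n * s (n + 2) = s (n + 1) ^ 2) (hlt : s 1 < s 0) : False := by
  have hpos : ∀ n, 0 < s n := fun n => by linarith [h2 n]
  have hratio : ∀ n, s (n + 1) = s 1 / s 0 * s n := by
    intro n
    induction n with
    | zero => rw [zero_add, div_mul_cancel₀ _ (hpos 0).ne']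
    | succ n ih =>
      have h1 := hs n
      have h3 : s n * s (n + 2) = s n * (s 1 / s 0 * s (n + 1)) := by
        rw [h1, pow_two]; nth_rewrite 1 [ih]; ring
      exact mul_left_cancel₀ (hpos n).ne' h3
  have hgeo : ∀ n, s n = (s 1 / s 0) ^ n * s 0 := by
    intro n
    induction n with
    | zero => simp
    | succ n ih => rw [hratio, ih]; ring
  have ht := (tendsto_pow_atTop_nhds_zero_of_lt_one (div_pos (hpos 1) (hpos 0)).le
    ((div_lt_one (hpos 0)).2 hlt)).mul_const (s 0)
  rw [zero_mul] at ht
  have := ge_of_tendsto' ht (b := 2) fun n => by rw [← hgeo]; exact h2 n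
  linarith

namespace ParabolicCone

/-- The neighbours of a region in the open cone lie in the half cone or equal `(1, 0)`, up to sign. -/
theorem two_le_norm (h : ParabolicCone μ F m) {a b : ℤ} {w : ℤ × ℤ} (ha : 0 < a) (hb : 0 < b)
    (hw : det (a, b) w = 1) : 2 ≤ ‖F w‖ := by
  have nonneg_case : ∀ w : ℤ × ℤ, |det (a, b) w| = 1 → 0 ≤ w.1 → 0 ≤ w.2 → 2 ≤ ‖F w‖ := by
    intro w hw h1 h2
    have hc : IsCoprime w.1 w.2 := by
      refine isCoprime_of_det (v := (a, b)) ?_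
      rw [← hw, ← abs_neg]; congr 1; simp [det]; ring
    rcases h2.eq_or_lt with h0 | h0
    · have : w = (1, 0) := by
        rw [← h0, isCoprime_zero_right, Int.isUnit_iff] at hc
        ext
        · simp only; omega
        · exact h0.symm
      rw [this, h.norm_eq_two]
    · exact h.two_lt.le.trans (h.le_norm ⟨hc, h1, h0⟩)
  have hd : a * w.2 - b * w.1 = 1 := hw
  rcases le_or_gt 0 w.1 with h1 | h1
  · exact nonneg_case w (by rw [hw]; rfl) h1 (by nlinarith)
  · rw [← h.markoff.neg]
    refine nonneg_case (-w) ?_ (by simp; omega) ?_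
    · have : det (a, b) (-w) = -1 := by simp [det]; linarith
      rw [this]; rfl
    · simp only [Prod.snd_neg, Left.nonneg_neg_iff]
      nlinarith

/-- A value with square `μ` would be surrounded by a bi-infinite sequence with geometric moduli. -/
theorem sq_ne (h : ParabolicCone μ F m) {p : ℤ × ℤ} (hp : p ∈ halfCone) (hp1 : 0 < p.1) :
    F p ^ 2 ≠ μ := by
  obtain ⟨a, b⟩ := p
  intro hμ
  have hm := h.two_lt.trans_le (h.le_norm hp)
  obtain ⟨⟨s, t, hst⟩, -, hb⟩ := hp
  simp only at hst hb hp1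
  let w : ℤ → ℤ × ℤ := fun n => (n * a - t, n * b + s)
  have hw : ∀ n, det (a, b) (w n) = 1 := fun n => by
    simp only [det, w]; linear_combination hst
  let S : ℤ → ℝ := fun n => ‖F (w n)‖
  have hS2 : ∀ n, 2 ≤ S n := fun n => h.two_le_norm hp1 hb (hw n)
  have hdet : ∀ n, |det (w n) (a, b)| = 1 := fun n => by
    have : det (w n) (a, b) = -1 := by have := hw n; simp only [det] at this ⊢; linarith
    rw [this]; rfl
  have hadd : ∀ n, w n + (a, b) = w (n + 1) := fun n => by ext <;> simp [w] <;> ring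
  have hsub : ∀ n, w n - (a, b) = w (n - 1) := fun n => by ext <;> simp [w] <;> ring
  have hedge : ∀ n, F (w n) * F (a, b) = F (w (n + 1)) + F (w (n - 1)) := fun n => by
    rw [← hadd, ← hsub]; exact h.markoff.edge _ _ (hdet n)
  have hS : ∀ n, S (n - 1) * S (n + 1) = S n ^ 2 := fun n => by
    have h1 := h.markoff.vertex _ _ (hdet n)
    rw [hadd] at h1
    have h3 : F (w (n - 1)) * F (w (n + 1)) = F (w n) ^ 2 := by
      linear_combination -h1 + hμ - F (w (n + 1)) * hedge n
    simp only [S]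
    rw [← norm_mul, h3, norm_pow]
  have hconv : 2 * S 0 < S 1 + S (-1) := by
    have h1 := congrArg norm (hedge 0)
    rw [norm_mul] at h1
    have h3 := norm_add_le (F (w (0 + 1))) (F (w (0 - 1)))
    have h4 := hS2 0
    simp only [zero_add, zero_sub] at h1 h3
    simp only [S] at h4 ⊢
    nlinarith
  rcases lt_or_ge (S 1) (S 0) with hlt | hge
  · refine false_of_geometric (s := fun n => S n) (fun n => hS2 n) (fun n => ?_) hlt
    have := hS (n + 1)
    push_cast
    rw [add_sub_cancel_right, add_assoc, one_add_one_eq_two] at this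
    exact this
  · have h0 := hS 0
    rw [zero_sub, zero_add] at h0
    have hlt : S (-1) < S 0 := by
      have p0 := hS2 0
      have p1 := hS2 1
      have p2 := hS2 (-1)
      by_contra hcon
      push Not at hcon
      nlinarith
    refine false_of_geometric (s := fun n => S (-n)) (fun n => hS2 _) (fun n => ?_) hlt
    have := hS (-(n + 1))
    push_cast
    rw [mul_comm] at this
    rw [show -((n : ℤ) + 1) + 1 = -n by ring, show -((n : ℤ) + 1) - 1 = -(n + 2) by ring] at this
    exact this

end ParabolicCone

/-! ### The identity in coordinates -/

theorem comb_mem_halfCone {u v : ℤ × ℤ} (huv : |det u v| = 1) (hu : 0 ≤ u.1) (hu' : 0 ≤ u.2)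
    (hv : 0 ≤ v.1) (hv' : 0 < v.2) {p : ℕ × ℕ} (hp : p ∈ openCone) : comb u v p ∈ halfCone := by
  refine ⟨isCoprime_comb huv hp.2.2, ?_, ?_⟩
  · simp only [comb]; positivity
  · have : (0 : ℤ) < p.2 := by exact_mod_cast hp.2.1
    simp only [comb]; positivity

namespace ParabolicCone

theorem tendsto_cobounded (h : ParabolicCone μ F m) (hμ : μ ≠ 4) :
    Tendsto (fun p : halfCone => F p) cofinite (cobounded ℂ) := by
  rw [← tendsto_norm_atTop_iff_cobounded, tendsto_atTop]
  intro R
  have h0 := (h.summable_weight hμ).tendsto_cofinite_zero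
  have hR : (0 : ℝ) < 1 / (|R| + 1) ^ 2 := by positivity
  filter_upwards [h0.eventually_lt_const hR] with p hp
  have h1 := (inv_norm_sq_le_weight h.two_lt (F p)).trans_lt hp
  have hpos : 0 < ‖F p‖ := by linarith [h.le_norm p.2, h.two_lt]
  rw [one_div_lt_one_div (by positivity) (by positivity),
    sq_lt_sq₀ (by positivity) (by positivity)] at h1
  linarith [le_abs_self R]

theorem exists_norm_hTerm_le (h : ParabolicCone μ F m) (hμ : μ ≠ 4) (τ : ℂ) :
    ∃ K : ℝ, 0 ≤ K ∧ ∀ p ∈ halfCone, ‖hTerm τ F p‖ ≤ K * weight m (F p) := by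
  have h1 := (frakH_isBigO τ).comp_tendsto (h.tendsto_cobounded hμ)
  have hne : ∀ p : halfCone, F p ≠ 0 := fun p h0 => by
    have := h.le_norm p.2
    rw [h0, norm_zero] at this
    linarith [h.two_lt]
  obtain ⟨K, hK⟩ := (isBigO_cofinite_iff (fun p hp => by
    simp only [Function.comp_apply, one_div, inv_eq_zero] at hp
    exact absurd (pow_eq_zero_iff two_ne_zero |>.1 hp) (hne p))).1 h1
  refine ⟨|K|, abs_nonneg K, fun p hp => (hK ⟨p, hp⟩).trans ?_⟩
  simp only [Function.comp_apply]
  rw [norm_div, norm_one, norm_pow]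
  exact mul_le_mul (le_abs_self K) (inv_norm_sq_le_weight h.two_lt _) (by positivity)
    (abs_nonneg K)

theorem exists_norm_inv_hNum_le (h : ParabolicCone μ F m) (hμ : μ ≠ 4) (τ : ℂ) :
    ∃ K : ℝ, ∀ p ∈ halfCone, ‖(hNum τ (F p))⁻¹‖ ≤ K := by
  have h1 := (inv_hNum_isBigO τ).comp_tendsto (h.tendsto_cobounded hμ)
  obtain ⟨K, hK⟩ := (isBigO_cofinite_iff (fun p hp => by simp at hp)).1 h1
  exact ⟨K, fun p hp => by simpa using hK ⟨p, hp⟩⟩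

theorem summable_norm_hTerm (h : ParabolicCone μ F m) (hμ : μ ≠ 4) (τ : ℂ) :
    Summable fun p : halfCone => ‖hTerm τ F p‖ := by
  obtain ⟨K, -, hK⟩ := h.exists_norm_hTerm_le hμ τ
  exact Summable.of_nonneg_of_le (fun _ => norm_nonneg _) (fun p => hK p p.2)
    ((h.summable_weight hμ).mul_left K)

theorem summable_norm_hTerm_comb (h : ParabolicCone μ F m) (hμ : μ ≠ 4) (τ : ℂ) {u v : ℤ × ℤ}
    (huv : |det u v| = 1) (hu : 0 ≤ u.1) (hu' : 0 ≤ u.2) (hv : 0 ≤ v.1) (hv' : 0 < v.2) :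
    Summable fun p : openCone => ‖hTerm τ F (comb u v p)‖ := by
  let j : openCone → halfCone := fun p => ⟨comb u v p, comb_mem_halfCone huv hu hu' hv hv' p.2⟩
  have hj : Function.Injective j := fun p q hpq =>
    Subtype.ext (comb_injective huv (congrArg Subtype.val hpq))
  have hs := Summable.comp_injective (i := j) (h.summable_norm_hTerm hμ τ) hj
  exact hs

theorem exists_norm_coneSum_le (h : ParabolicCone μ F m) (hμ : μ ≠ 4) (τ : ℂ) :
    ∃ K : ℝ, 0 ≤ K ∧ ∀ u v, GoodEdge F m u v →
      ‖coneSum (hTerm τ F) u v‖ ≤ K * (weight m (F u) * weight m (F v)) := by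
  have hm := h.two_lt
  obtain ⟨K, hK0, hK⟩ := h.exists_norm_hTerm_le hμ τ
  set ρ := ((m - 1)⁻¹) ^ 2 with hρ
  have hρ0 : 0 ≤ ρ := sq_nonneg _
  have hgeo : Summable fun n : ℕ => ρ ^ (n - 1) := by
    rw [← summable_nat_add_iff 1]
    exact summable_geometric_of_lt_one hρ0 (inv_sub_one_sq_lt_one hm)
  have hs : Summable fun p : openCone => ρ ^ (p.1.1 - 1) * ρ ^ (p.1.2 - 1) :=
    (hgeo.mul_of_nonneg hgeo (fun _ => pow_nonneg hρ0 _)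
      (fun _ => pow_nonneg hρ0 _)).subtype openCone
  have hs0 : 0 ≤ ∑' p : openCone, ρ ^ (p.1.1 - 1) * ρ ^ (p.1.2 - 1) :=
    tsum_nonneg fun p => mul_nonneg (pow_nonneg hρ0 _) (pow_nonneg hρ0 _)
  refine ⟨K * ∑' p : openCone, ρ ^ (p.1.1 - 1) * ρ ^ (p.1.2 - 1), mul_nonneg hK0 hs0, ?_⟩
  intro u v hg
  have wu := weight_nonneg m (F u)
  have wv := weight_nonneg m (F v)
  have lu := weight_le hm hg.left
  have lv := weight_le hm hg.right
  have hpow : ∀ (w : ℝ), 0 ≤ w → w ≤ ρ → ∀ n : ℕ, 0 < n → w ^ n ≤ w * ρ ^ (n - 1) := by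
    intro w hw hwρ n hn
    obtain ⟨k, rfl⟩ := Nat.exists_eq_succ_of_ne_zero hn.ne'
    rw [Nat.succ_eq_add_one, pow_succ', Nat.add_sub_cancel]
    gcongr
  have hterm : ∀ p : openCone, ‖hTerm τ F (comb u v p)‖ ≤
      (K * (weight m (F u) * weight m (F v))) * (ρ ^ (p.1.1 - 1) * ρ ^ (p.1.2 - 1)) := by
    intro p
    have hmem : comb u v p ∈ halfCone := comb_mem_halfCone hg.det_eq hg.left_mem.2.1
      hg.left_mem.2.2.le hg.right_mem.2.1 hg.right_mem.2.2 p.2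
    calc ‖hTerm τ F (comb u v p)‖ ≤ K * weight m (F (comb u v p)) := hK _ hmem
      _ ≤ K * (weight m (F u) ^ p.1.1 * weight m (F v) ^ p.1.2) :=
        mul_le_mul_of_nonneg_left (GoodEdge.growth h.markoff hm p p.2 u v hg).2 hK0
      _ ≤ K * ((weight m (F u) * ρ ^ (p.1.1 - 1)) * (weight m (F v) * ρ ^ (p.1.2 - 1))) := by
        refine mul_le_mul_of_nonneg_left (mul_le_mul (hpow _ wu lu _ p.2.1)
          (hpow _ wv lv _ p.2.2.1) (by positivity) (by positivity)) hK0
      _ = _ := by ring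
  refine (tsum_of_norm_bounded (hs.mul_left _).hasSum hterm).trans (le_of_eq ?_)
  rw [tsum_mul_left]
  ring

/-- The hypothesis `hsq` concerns, besides the open cone, the vector `(0, 1)`. -/
theorem exists_norm_defect_sub_one_le (h : ParabolicCone (τ + 2) F m) (hμ : τ + 2 ≠ 4)
    (hsq : ∀ p ∈ halfCone, F p ^ 2 ≠ τ + 2) :
    ∃ K : ℝ, 0 ≤ K ∧ ∀ u v, GoodEdge F m u v →
      ‖defect τ (F u) (F v) (F (u - v)) - 1‖ ≤ K * (weight m (F u) * weight m (F v)) := by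
  have hm := h.two_lt
  obtain ⟨N, hN⟩ := h.exists_norm_inv_hNum_le hμ τ
  obtain ⟨η, hη, hη'⟩ : ∃ η > 0, 1 - 1 / (m - 1) = 2 * η :=
    ⟨(1 - 1 / (m - 1)) / 2, by
      have : 1 / (m - 1) < 1 := by rw [div_lt_one (by linarith)]; linarith
      linarith, by ring⟩
  set R : ℝ := 2 + 1 / η with hR
  have hη1 : 0 < 1 / η := one_div_pos.2 hη
  have hRη : 1 / (R * (R - 1)) ≤ η := by
    rw [one_div_le (mul_pos (by linarith) (by linarith)) hη]
    nlinarith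
  -- only finitely many edges have two small labels
  have hfin : (Subtype.val '' {p : halfCone | ‖F p‖ ≤ R}).Finite := by
    refine Set.Finite.image _ ?_
    have h1 := (tendsto_norm_atTop_iff_cobounded.2 (h.tendsto_cobounded hμ)).eventually_gt_atTop R
    rw [eventually_cofinite] at h1
    simpa using h1
  obtain ⟨K₂, hK₂⟩ := ((hfin.prod hfin).image fun e : (ℤ × ℤ) × (ℤ × ℤ) =>
    ‖defect τ (F e.1) (F e.2) (F (e.1 - e.2)) - 1‖ /
      (weight m (F e.1) * weight m (F e.2))).bddAbove
  set C := N ^ 2 * ‖expNu τ - 1‖ * ((2 + 4 * ‖τ + 2‖) / η + ‖expNu τ - 1‖) with hC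
  have hC0 : 0 ≤ C := by positivity
  refine ⟨max (C * 4) K₂, le_max_of_le_left (by positivity), fun u v hg => ?_⟩
  have wu := weight_pos hm hg.left
  have wv := weight_pos hm hg.right
  rcases le_or_gt R (max ‖F u‖ ‖F v‖) with hlarge | hsmall
  · have hu2 : 2 ≤ ‖F u‖ := hm.le.trans hg.left
    have hv2 : 2 ≤ ‖F v‖ := hm.le.trans hg.right
    have hsep := le_norm_one_sub_h_sub_h_sub hm (by linarith) hg.left hg.right hg.opp hlarge
    have hvert : F u ^ 2 + F v ^ 2 + F (u - v) ^ 2 - F u * F v * F (u - v) = τ + 2 := by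
      linear_combination h.markoff.vertex u v hg.det_eq +
        (F (u - v) - F (u + v)) * (h.markoff.edge u v hg.det_eq) * (-1)
    have hb := norm_defect_sub_one_le hη hu2 hv2 (hsq u hg.left_mem) (hsq v hg.right_mem) hvert
      (hN u hg.left_mem) (hN v hg.right_mem) (by linarith)
    have hh : ∀ z : ℂ, 2 ≤ ‖z‖ → ‖Markoff.h z‖ ≤ 2 * weight m z := fun z hz => by
      have h1 := norm_h_le_two_div_sq hz
      have h2 := inv_norm_sq_le_weight hm z
      rw [← mul_one_div] at h1
      linarith
    calc _ ≤ C * (‖Markoff.h (F u)‖ * ‖Markoff.h (F v)‖) := hb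
      _ ≤ C * ((2 * weight m (F u)) * (2 * weight m (F v))) := by
        have h1 := hh _ hu2
        have h2 := hh _ hv2
        gcongr
      _ = C * 4 * (weight m (F u) * weight m (F v)) := by ring
      _ ≤ _ := mul_le_mul_of_nonneg_right (le_max_left _ _) (by positivity)
  · have hu : u ∈ Subtype.val '' {p : halfCone | ‖F p‖ ≤ R} :=
      ⟨⟨u, hg.left_mem⟩, (le_max_left _ _).trans hsmall.le, rfl⟩
    have hv : v ∈ Subtype.val '' {p : halfCone | ‖F p‖ ≤ R} :=
      ⟨⟨v, hg.right_mem⟩, (le_max_right _ _).trans hsmall.le, rfl⟩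
    have hb := hK₂ ⟨(u, v), ⟨hu, hv⟩, rfl⟩
    simp only at hb
    rw [div_le_iff₀ (mul_pos wu wv)] at hb
    exact hb.trans (mul_le_mul_of_nonneg_right (le_max_right _ _) (by positivity))

theorem edgeRatio_goodEdge (h : ParabolicCone (τ + 2) F m) (hμ : τ + 2 ≠ 4)
    (hsq : ∀ p ∈ halfCone, F p ^ 2 ≠ τ + 2) {u v : ℤ × ℤ} (hg : GoodEdge F m u v) :
    edgeRatio τ F u v = 1 := by
  have hm := h.two_lt
  have hne : ∀ p ∈ halfCone, F p ≠ 0 := fun p hp h0 => by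
    have := h.le_norm hp
    rw [h0, norm_zero] at this
    linarith
  obtain ⟨K₁, hK₁0, hK₁⟩ := h.exists_norm_coneSum_le hμ τ
  obtain ⟨K₂, hK₂0, hK₂⟩ := h.exists_norm_defect_sub_one_le hμ hsq
  refine eq_one_of_multiplicative (K := K₂ * Real.exp K₁ + K₁ * Real.exp K₁) h.markoff hm
    (by positivity) (fun u v hg => ?_) (fun u v hg => ?_) hg
  · have hadd := add_mem_halfCone hg.left_mem hg.right_mem hg.det_eq
    exact edgeRatio_eq_mul h.markoff hg.det_eq (hne _ hg.left_mem) (hne _ hg.right_mem)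
      (hne _ hadd) (hsq _ hadd) (h.summable_norm_hTerm_comb hμ τ hg.det_eq hg.left_mem.2.1
      hg.left_mem.2.2.le hg.right_mem.2.1 hg.right_mem.2.2).of_norm
  · set W := weight m (F u) * weight m (F v) with hW
    have hρ := (inv_sub_one_sq_lt_one hm).le
    have hW0 : 0 ≤ W := mul_nonneg (weight_nonneg _ _) (weight_nonneg _ _)
    have hW1 : W ≤ 1 := mul_le_one₀ ((weight_le hm hg.left).trans hρ) (weight_nonneg _ _)
      ((weight_le hm hg.right).trans hρ)
    set S := coneSum (hTerm τ F) u v with hS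
    have hSle : ‖-S‖ ≤ K₁ * W := by rw [norm_neg]; exact hK₁ u v hg
    have hS1 : ‖-S‖ ≤ K₁ := hSle.trans (mul_le_of_le_one_right hK₁0 hW1)
    have e1 : ‖Complex.exp (-S)‖ ≤ Real.exp K₁ :=
      (Complex.norm_exp_le_exp_norm _).trans (Real.exp_le_exp.2 hS1)
    have e2 : ‖Complex.exp (-S) - 1‖ ≤ K₁ * W * Real.exp K₁ := by
      have h1 := Complex.norm_exp_sub_sum_le_norm_mul_exp (-S) 1
      simp only [Finset.sum_range_one, pow_zero, Nat.factorial_zero, Nat.cast_one, div_one,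
        pow_one] at h1
      have h2 := Real.exp_le_exp.2 hS1
      exact h1.trans (by gcongr)
    have e3 := hK₂ u v hg
    have e4 : edgeRatio τ F u v - 1 = (defect τ (F u) (F v) (F (u - v)) - 1) * Complex.exp (-S) +
        (Complex.exp (-S) - 1) := by
      rw [edgeRatio]; ring
    rw [e4]
    refine (norm_add_le _ _).trans ?_
    rw [norm_mul]
    have e5 := mul_le_mul e3 e1 (norm_nonneg _) (by positivity)
    linarith

theorem tendsto_coneSum_fan (h : ParabolicCone μ F m) (hμ : μ ≠ 4) (τ : ℂ) :
    Tendsto (fun n : ℕ => coneSum (hTerm τ F) (1, 0) (n, 1)) atTop (𝓝 0) := by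
  have hs : Summable fun p : halfCone => hTerm τ F p := (h.summable_norm_hTerm hμ τ).of_norm
  have hdet : ∀ n : ℕ, |det (1, 0) ((n : ℤ), 1)| = 1 := fun n => by simp [det]
  let j : ∀ n : ℕ, openCone → halfCone := fun n p => ⟨comb (1, 0) (n, 1) p,
    comb_mem_halfCone (hdet n) (by simp) (by simp) (by simp) (by simp) p.2⟩
  have hj : ∀ n, Function.Injective (j n) := fun n p q hpq =>
    Subtype.ext (comb_injective (hdet n) (congrArg Subtype.val hpq))
  -- the regions behind the edge `(1, 0), (n, 1)` eventually leave every finite set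
  intro U hU
  obtain ⟨s, hs'⟩ := hs.tsum_vanishing hU
  have hev : ∀ᶠ n : ℕ in atTop, ∀ p ∈ s, p.1.1 < (n : ℤ) := by
    rw [Filter.eventually_all_finset]
    intro p _
    filter_upwards [eventually_gt_atTop p.1.1.toNat] with n hn
    omega
  rw [mem_map]
  filter_upwards [hev] with n hn
  have hdis : Disjoint (Set.range (j n)) (s : Set halfCone) := by
    rw [Set.disjoint_left]
    rintro _ ⟨p, rfl⟩ hp
    have h1 := hn _ hp
    have h2 : 1 ≤ p.1.2 := p.2.2.1
    simp only [j, comb] at h1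
    have h3 : (n : ℤ) ≤ p.1.2 * n := le_mul_of_one_le_left (by positivity) (by exact_mod_cast h2)
    have h4 : (0 : ℤ) ≤ p.1.1 := by positivity
    linarith
  have h1 := hs' _ hdis
  rw [tsum_range (fun p : halfCone => hTerm τ F p) (hj n)] at h1
  exact h1

/-- The edges along `(1, 0)` run into the cusp, where `φ(n, 1) / (φ(1, 0) φ(n + 1, 1))` tends to
`1 / 2 = h(±2)`. -/
theorem tendsto_defect_fan (h : ParabolicCone (τ + 2) F m) (hμ : τ + 2 ≠ 4) :
    Tendsto (fun n : ℕ => defect τ (F (1, 0)) (F ((n + 1 : ℕ), 1)) (F (n, 1))) atTop (𝓝 1) := by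
  obtain ⟨σ, δ, hσ, hF0, -, hn⟩ := h.markoff.fan_eq h.parabolic
  have hσ0 : σ ≠ 0 := by rintro rfl; simp at hσ
  have hσ1 : ‖σ‖ = 1 := by
    have := congrArg norm hσ
    rw [norm_pow, norm_one] at this
    exact (pow_eq_one_iff_of_nonneg (norm_nonneg _) two_ne_zero).1 this
  have hx0 : F (1, 0) ≠ 0 := by rw [hF0]; exact mul_ne_zero two_ne_zero hσ0
  have hxμ : F (1, 0) ^ 2 ≠ τ + 2 := by
    rw [hF0, mul_pow, hσ]; intro h0; exact hμ (by rw [← h0]; norm_num)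
  have hnum := hNum_ne_zero hx0 hxμ
  have hfan : Tendsto (fun n : ℕ => F ((n + 1 : ℕ), 1)) atTop (cobounded ℂ) :=
    (h.markoff.tendsto_fan hμ h.parabolic).comp (tendsto_add_atTop_nat 1)
  have hline : Tendsto (fun n : ℕ => F (0, 1) + ((n + 1 : ℕ) : ℂ) * δ) atTop (cobounded ℂ) := by
    rw [← tendsto_norm_atTop_iff_cobounded] at hfan ⊢
    refine hfan.congr fun n => ?_
    rw [hn, norm_mul, norm_pow, hσ1, one_pow, one_mul]
  have hc : Tendsto (fun n : ℕ => F (n, 1) / (F (1, 0) * F ((n + 1 : ℕ), 1))) atTop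
      (𝓝 (1 / 2)) := by
    have h1 := ((tendsto_inv₀_cobounded (α := ℂ)).comp hline).const_mul (-δ / 2)
    rw [mul_zero] at h1
    have h2 := h1.const_add (1 / 2)
    rw [add_zero] at h2
    refine h2.congr' ?_
    filter_upwards [hline.eventually_ne_cobounded 0] with n hne
    simp only [Function.comp_apply]
    rw [hn n, hn (n + 1), hF0]
    push_cast at hne ⊢
    have hσn : σ ^ n ≠ 0 := pow_ne_zero n hσ0
    rw [pow_succ]
    have e1 : 2 * σ * (σ ^ n * σ * (F (0, 1) + (n + 1) * δ)) =
        2 * σ ^ n * (F (0, 1) + (n + 1) * δ) := by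
      linear_combination 2 * σ ^ n * (F (0, 1) + (n + 1) * δ) * hσ
    rw [e1]
    set L := F (0, 1) + (n + 1) * δ with hL
    rw [show F (0, 1) + n * δ = L - δ by rw [hL]; ring]
    field_simp
    ring
  have h1 : Tendsto (fun n : ℕ => defect τ (F (1, 0)) (F ((n + 1 : ℕ), 1)) (F (n, 1))) atTop
      (𝓝 ((1 + (expNu τ - 1) * (1 / 2)) / (hNum τ (F (1, 0)) * 1))) :=
    ((hc.const_mul _).const_add 1).div (((hNum_tendsto_one τ).comp hfan).const_mul _)
      (by simpa using hnum)
  have h2 : 1 + (expNu τ - 1) * (1 / 2) = hNum τ (F (1, 0)) := by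
    rw [hNum, h_of_eq_two_or h.parabolic]
  rwa [h2, mul_one, div_self hnum] at h1

/-- The identity for the edge between `(1, 0)` and `(0, 1)`, in exponentiated form. -/
theorem exp_coneSum (h : ParabolicCone (τ + 2) F m) (hμ : τ + 2 ≠ 4)
    (hsq : F (0, 1) ^ 2 ≠ τ + 2) :
    Complex.exp (coneSum (hTerm τ F) (1, 0) (0, 1)) =
      defect τ (F (1, 0)) (F (0, 1)) (F (1, -1)) := by
  have hm := h.two_lt
  have hsq' : ∀ p ∈ halfCone, F p ^ 2 ≠ τ + 2 := by
    intro p hp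
    rcases hp.2.1.eq_or_lt with h0 | h0
    · have hc := hp.1
      rw [← h0, isCoprime_zero_left, Int.isUnit_iff] at hc
      have hp2 := hp.2.2
      have : p = (0, 1) := by
        ext
        · exact h0.symm
        · simp only; omega
      rwa [this]
    · exact h.sq_ne hp h0
  have hne : ∀ p ∈ halfCone, F p ≠ 0 := fun p hp h0 => by
    have := h.le_norm hp
    rw [h0, norm_zero] at this
    linarith
  have hx0 : F (1, 0) ≠ 0 := by
    rw [← norm_pos_iff, h.norm_eq_two]; norm_num
  have hdet : ∀ n : ℕ, |det (1, 0) ((n : ℤ), 1)| = 1 := fun n => by simp [det]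
  have hstep : ∀ n : ℕ, edgeRatio τ F (1, 0) (n, 1) = edgeRatio τ F (1, 0) ((n + 1 : ℕ), 1) := by
    intro n
    have hadd : ((1 : ℤ), (0 : ℤ)) + ((n : ℤ), 1) = (((n + 1 : ℕ) : ℤ), 1) := by
      ext
      · simp; ring
      · simp
    have hmem := fan_mem_halfCone (n + 1)
    have h1 := edgeRatio_eq_mul h.markoff (hdet n) hx0 (hne _ (fan_mem_halfCone n))
      (by rw [hadd]; exact hne _ hmem) (by rw [hadd]; exact hsq' _ hmem)
      (h.summable_norm_hTerm_comb hμ τ (hdet n) (by simp) (by simp) (by simp) (by simp)).of_norm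
    rw [hadd] at h1
    have h2 := h.edgeRatio_goodEdge hμ hsq' (h.goodEdge n)
    rw [show ((n : ℤ) + 1, (1 : ℤ)) = (((n + 1 : ℕ) : ℤ), 1) by push_cast; rfl] at h2
    rw [h1, h2, mul_one]
  have hconst : ∀ n : ℕ, edgeRatio τ F (1, 0) (n, 1) = edgeRatio τ F (1, 0) (0, 1) := by
    intro n
    induction n with
    | zero => rfl
    | succ n ih => rw [← hstep, ih]
  have hlim : Tendsto (fun n : ℕ => edgeRatio τ F (1, 0) ((n + 1 : ℕ), 1)) atTop (𝓝 1) := by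
    have h1 := ((h.tendsto_coneSum_fan hμ τ).comp (tendsto_add_atTop_nat 1)).neg
    have h2 := (Complex.continuous_exp.tendsto _).comp h1
    rw [neg_zero, Complex.exp_zero] at h2
    have h3 := (h.tendsto_defect_fan hμ).mul h2
    rw [mul_one] at h3
    refine h3.congr fun n => ?_
    have : ((1 : ℤ), (0 : ℤ)) - (((n + 1 : ℕ) : ℤ), 1) = -((n : ℤ), 1) := by
      ext <;> simp
    rw [edgeRatio, this, h.markoff.neg]
    rfl
  have h1 : edgeRatio τ F (1, 0) (0, 1) = 1 :=
    tendsto_nhds_unique (hlim.congr fun n => hconst (n + 1)) tendsto_const_nhds |>.symm ▸ rfl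
  rw [edgeRatio, show ((1 : ℤ), (0 : ℤ)) - (0, 1) = (1, -1) by ext <;> simp] at h1
  rw [Complex.exp_neg] at h1
  exact (mul_inv_eq_one₀ (Complex.exp_ne_zero _)).1 h1 |>.symm

end ParabolicCone

end Analysis

/-! ### The cone of a directed edge in the Farey tessellation -/

/-- The primitive vector that represents a region, with denominator `≥ 0`. -/
def vec (X : Region) : ℤ × ℤ := (num X, den X)

/-- The region represented by a nonzero vector: the slope `p / q` of `(p, q)`. -/
def reg (p : ℤ × ℤ) : Region := if p.2 = 0 then OnePoint.infty else ((p.1 / p.2 : ℚ) : OnePoint ℚ)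

theorem isCoprime_vec (X : Region) : IsCoprime (vec X).1 (vec X).2 := by
  induction X using OnePoint.rec with
  | infty => exact isCoprime_one_left
  | coe r =>
    change IsCoprime r.num (r.den : ℤ)
    rw [Int.isCoprime_iff_gcd_eq_one]
    exact r.reduced

theorem reg_vec (X : Region) : reg (vec X) = X := by
  induction X using OnePoint.rec with
  | infty => rfl
  | coe r =>
    change (if (r.den : ℤ) = 0 then _ else (((r.num : ℚ) / ((r.den : ℤ) : ℚ) : ℚ) : OnePoint ℚ)) = _
    rw [if_neg (by exact_mod_cast r.den_nz)]
    congr 1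
    exact_mod_cast r.num_div_den

theorem reg_neg (p : ℤ × ℤ) : reg (-p) = reg p := by
  simp [reg]

theorem vec_reg {p : ℤ × ℤ} (hp : IsCoprime p.1 p.2) : vec (reg p) = p ∨ vec (reg p) = -p := by
  have key : ∀ p : ℤ × ℤ, IsCoprime p.1 p.2 → 0 < p.2 → vec (reg p) = p := by
    intro p hp h0
    have hc : Nat.Coprime p.1.natAbs p.2.natAbs := Int.isCoprime_iff_gcd_eq_one.1 hp
    rw [reg, if_neg h0.ne']
    ext
    · exact Rat.num_div_eq_of_coprime h0 hc
    · exact Rat.den_div_eq_of_coprime h0 hc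
  rcases lt_trichotomy p.2 0 with h0 | h0 | h0
  · right
    rw [← reg_neg]
    exact key (-p) (by simpa using hp.neg_neg) (by simpa using h0)
  · have h1 : p.1 = 1 ∨ p.1 = -1 := by
      rw [h0, isCoprime_zero_right] at hp; exact Int.isUnit_iff.1 hp
    have h2 : vec (reg p) = (1, 0) := by rw [reg, if_pos h0]; rfl
    rw [h2]
    rcases h1 with h1 | h1
    · left; ext <;> simp [h0, h1]
    · right; ext <;> simp [h0, h1]
  · exact Or.inl (key p hp h0)

theorem eq_or_eq_neg_of_reg_eq {p q : ℤ × ℤ} (hp : IsCoprime p.1 p.2) (hq : IsCoprime q.1 q.2)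
    (hpq : reg p = reg q) : p = q ∨ p = -q := by
  rcases vec_reg hp with h1 | h1 <;> rcases vec_reg hq with h2 | h2 <;> rw [hpq, h2] at h1
  · exact Or.inl h1.symm
  · exact Or.inr h1.symm
  · right; rw [h1, neg_neg]
  · left; exact (neg_injective h1).symm

theorem det_neg_left (p q : ℤ × ℤ) : det (-p) q = -det p q := by simp [det]; ring

theorem det_neg_right (p q : ℤ × ℤ) : det p (-q) = -det p q := by simp [det]; ring

theorem det_swap (p q : ℤ × ℤ) : det q p = -det p q := by simp [det]; ring

theorem abs_det_swap (p q : ℤ × ℤ) : |det q p| = |det p q| := by rw [det_swap, abs_neg]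

theorem adj_iff_abs_det_vec (X Y : Region) : farey.Adj X Y ↔ |det (vec X) (vec Y)| = 1 := by
  have : det (vec X) (vec Y) = num X * den Y - num Y * den X := by
    simp only [det, vec]; ring
  rw [this]; rfl

theorem adj_reg_iff {p q : ℤ × ℤ} (hp : IsCoprime p.1 p.2) (hq : IsCoprime q.1 q.2) :
    farey.Adj (reg p) (reg q) ↔ |det p q| = 1 := by
  rw [adj_iff_abs_det_vec]
  rcases vec_reg hp with h1 | h1 <;> rcases vec_reg hq with h2 | h2 <;>
    simp [h1, h2, det_neg_left, det_neg_right]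

theorem adj_reg {p q : ℤ × ℤ} (hpq : |det p q| = 1) : farey.Adj (reg p) (reg q) :=
  (adj_reg_iff (isCoprime_of_det hpq) (isCoprime_of_det (v := p) (by rwa [abs_det_swap]))).2 hpq

/-- The vector with coordinates `c` with respect to `x`, `y`. -/
def lin (x y c : ℤ × ℤ) : ℤ × ℤ := (c.1 * x.1 + c.2 * y.1, c.1 * x.2 + c.2 * y.2)

section Lin

variable {x y : ℤ × ℤ}

theorem det_lin (x y c d : ℤ × ℤ) : det (lin x y c) (lin x y d) = det c d * det x y := by
  simp [det, lin]; ring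

theorem lin_add (x y c d : ℤ × ℤ) : lin x y (c + d) = lin x y c + lin x y d := by
  ext <;> simp [lin] <;> ring

theorem lin_sub (x y c d : ℤ × ℤ) : lin x y (c - d) = lin x y c - lin x y d := by
  ext <;> simp [lin] <;> ring

theorem lin_neg (x y c : ℤ × ℤ) : lin x y (-c) = -lin x y c := by
  ext <;> simp [lin] <;> ring

theorem lin_one_zero (x y : ℤ × ℤ) : lin x y (1, 0) = x := by ext <;> simp [lin]

theorem lin_zero_one (x y : ℤ × ℤ) : lin x y (0, 1) = y := by ext <;> simp [lin]

theorem lin_one_one (x y : ℤ × ℤ) : lin x y (1, 1) = x + y := by ext <;> simp [lin]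

theorem lin_one_neg_one (x y : ℤ × ℤ) : lin x y (1, -1) = x - y := by
  ext <;> simp [lin] <;> ring

theorem lin_swap (x y c : ℤ × ℤ) : lin x y c.swap = lin y x c := by
  ext <;> simp [lin] <;> ring

theorem abs_det_lin (hxy : |det x y| = 1) (c d : ℤ × ℤ) :
    |det (lin x y c) (lin x y d)| = |det c d| := by
  rw [det_lin, abs_mul, hxy, mul_one]

theorem lin_injective (hxy : |det x y| = 1) : Function.Injective (lin x y) := by
  intro c d hcd
  have h0 : det x y ≠ 0 := by intro h0; simp [h0] at hxy
  have h1 : ∀ c, det (lin x y c) y = c.1 * det x y := fun c => by simp [det, lin]; ring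
  have h2 : ∀ c, det x (lin x y c) = c.2 * det x y := fun c => by simp [det, lin]; ring
  ext
  · exact mul_right_cancel₀ h0 (by rw [← h1, ← h1, hcd])
  · exact mul_right_cancel₀ h0 (by rw [← h2, ← h2, hcd])

theorem exists_lin_eq (hxy : |det x y| = 1) (r : ℤ × ℤ) : ∃ c, lin x y c = r := by
  have hs : det x y * det x y = 1 := by rw [← abs_mul_abs_self, hxy, one_mul]
  refine ⟨(det x y * det r y, det x y * det x r), ?_⟩
  have hd : det x y = x.1 * y.2 - x.2 * y.1 := rfl
  have h1 : det r y = r.1 * y.2 - r.2 * y.1 := rfl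
  have h2 : det x r = x.1 * r.2 - x.2 * r.1 := rfl
  ext
  · simp only [lin]
    linear_combination r.1 * hs + det x y * x.1 * h1 + det x y * y.1 * h2 - det x y * r.1 * hd
  · simp only [lin]
    linear_combination r.2 * hs + det x y * x.2 * h1 + det x y * y.2 * h2 - det x y * r.2 * hd

theorem isCoprime_lin_iff (hxy : |det x y| = 1) (c : ℤ × ℤ) :
    IsCoprime (lin x y c).1 (lin x y c).2 ↔ IsCoprime c.1 c.2 := by
  constructor
  · rintro ⟨s, t, hst⟩
    refine ⟨s * x.1 + t * x.2, s * y.1 + t * y.2, ?_⟩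
    simp only [lin] at hst
    linear_combination hst
  · rintro ⟨s, t, hst⟩
    have h1 : |det c (-t, s)| = 1 := by
      have : det c (-t, s) = 1 := by simp only [det]; linear_combination hst
      rw [this]; rfl
    rw [← abs_det_lin hxy] at h1
    exact isCoprime_of_det h1

end Lin

/-- Two neighbouring regions have exactly two common neighbours. -/
theorem eq_reg_add_or_sub {p q : ℤ × ℤ} (hpq : |det p q| = 1) {T : Region}
    (hp : farey.Adj (reg p) T) (hq : farey.Adj (reg q) T) :
    T = reg (p + q) ∨ T = reg (p - q) := by
  obtain ⟨c, hc⟩ := exists_lin_eq hpq (vec T)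
  have hcT := isCoprime_vec T
  have hqc := isCoprime_of_det (u := q) (v := p) (by rwa [abs_det_swap])
  rw [← reg_vec T, adj_reg_iff (isCoprime_of_det hpq) hcT, ← hc] at hp
  rw [← reg_vec T, adj_reg_iff hqc hcT, ← hc] at hq
  nth_rewrite 1 [← lin_one_zero p q] at hp
  nth_rewrite 1 [← lin_zero_one p q] at hq
  rw [abs_det_lin hpq] at hp hq
  simp only [det, one_mul, zero_mul, sub_zero, zero_sub, abs_neg] at hp hq
  obtain ⟨a, b⟩ := c
  rw [← reg_vec T, ← hc]
  rcases eq_or_eq_neg_of_abs_eq hq with h1 | h1 <;> rcases eq_or_eq_neg_of_abs_eq hp with h2 | h2 <;>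
    simp only at h1 h2 <;> subst h1 h2
  · left; rw [lin_one_one]
  · right; rw [lin_one_neg_one]
  · right; rw [← lin_one_neg_one, ← reg_neg, ← lin_neg]; rfl
  · left; rw [← lin_one_one, ← reg_neg, ← lin_neg]; rfl

theorem Vertex.adj (v : Vertex) {R S : Region} (hR : R ∈ v.1) (hS : S ∈ v.1) (hRS : R ≠ S) :
    farey.Adj R S := v.2.isClique hR hS hRS

theorem Vertex.eq_insert (v : Vertex) {R S : Region} (hR : R ∈ v.1) (hS : S ∈ v.1) (hRS : R ≠ S) :
    ∃ T, v.1 = {R, S, T} ∧ farey.Adj R T ∧ farey.Adj S T := by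
  have hcard : ((v.1.erase R).erase S).card = 1 := by
    rw [Finset.card_erase_of_mem (Finset.mem_erase.2 ⟨hRS.symm, hS⟩), Finset.card_erase_of_mem hR,
      v.2.card_eq]
  obtain ⟨T, hT⟩ := Finset.card_eq_one.1 hcard
  have hTm : T ∈ (v.1.erase R).erase S := by rw [hT]; exact Finset.mem_singleton_self T
  simp only [Finset.mem_erase] at hTm
  refine ⟨T, ?_, v.adj hR hTm.2.2 hTm.2.1.symm, v.adj hS hTm.2.2 hTm.1.symm⟩
  rw [← hT, Finset.insert_erase (Finset.mem_erase.2 ⟨hRS.symm, hS⟩), Finset.insert_erase hR]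

/-- The triangle spanned by two vectors of determinant `±1` and their sum. -/
def triangle (p q : ℤ × ℤ) (hpq : |det p q| = 1) : Vertex :=
  ⟨{reg p, reg q, reg (p + q)}, SimpleGraph.is3Clique_iff.2 ⟨_, _, _, adj_reg hpq,
    adj_reg (by rwa [det_add_right]), adj_reg (by
      rw [abs_det_swap, det_add_left]; exact hpq), rfl⟩⟩

theorem exists_mem_vertex (X : Region) : ∃ v : Vertex, X ∈ v.1 := by
  obtain ⟨s, t, hst⟩ := isCoprime_vec X
  refine ⟨triangle (vec X) (-t, s) ?_, ?_⟩
  · have : det (vec X) (-t, s) = 1 := by simp only [det]; linear_combination hst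
    rw [this]; rfl
  · simp [triangle, reg_vec]

/-- A basis of `ℤ²` adapted to a directed edge: the tail is `x + y` and the head `x - y`. -/
structure DirectedEdge.IsBasis (e : DirectedEdge) (x y : ℤ × ℤ) : Prop where
  det_eq : |det x y| = 1
  X_eq : e.X = reg x
  Y_eq : e.Y = reg y
  Z_eq : e.Z = reg (x + y)
  W_eq : e.W = reg (x - y)

theorem DirectedEdge.exists_isBasis (e : DirectedEdge) : ∃ x y, e.IsBasis x y := by
  have h0 := (adj_iff_abs_det_vec _ _).1 e.adjXY
  have aX : ∀ {T}, farey.Adj e.X T → farey.Adj (reg (vec e.X)) T := fun h => by rwa [reg_vec]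
  have aY : ∀ {T}, farey.Adj e.Y T → farey.Adj (reg (vec e.Y)) T := fun h => by rwa [reg_vec]
  rcases eq_reg_add_or_sub h0 (aX e.adjXZ) (aY e.adjYZ) with hZ | hZ <;>
    rcases eq_reg_add_or_sub h0 (aX e.adjXW) (aY e.adjYW) with hW | hW
  · exact absurd (hZ.trans hW.symm) e.Z_ne_W
  · exact ⟨vec e.X, vec e.Y, h0, (reg_vec _).symm, (reg_vec _).symm, hZ, hW⟩
  · refine ⟨vec e.X, -vec e.Y, ?_, (reg_vec _).symm, ?_, ?_, ?_⟩
    · rwa [det_neg_right, abs_neg]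
    · rw [reg_neg, reg_vec]
    · rw [← sub_eq_add_neg]; exact hZ
    · rw [sub_neg_eq_add]; exact hW
  · exact absurd (hZ.trans hW.symm) e.Z_ne_W

/-- The regions in the closed cone of the basis `x`, `y`. -/
def closedCone (x y : ℤ × ℤ) : Set Region :=
  {R | ∃ c : ℤ × ℤ, IsCoprime c.1 c.2 ∧ 0 ≤ c.1 ∧ 0 ≤ c.2 ∧ R = reg (lin x y c)}

theorem eq_of_reg_lin_eq {x y c d : ℤ × ℤ} (hxy : |det x y| = 1) (hc : IsCoprime c.1 c.2)
    (hd : IsCoprime d.1 d.2) (hcd : reg (lin x y c) = reg (lin x y d)) : c = d ∨ c = -d := by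
  rcases eq_or_eq_neg_of_reg_eq ((isCoprime_lin_iff hxy c).2 hc) ((isCoprime_lin_iff hxy d).2 hd)
    hcd with h | h
  · exact Or.inl (lin_injective hxy h)
  · exact Or.inr (lin_injective hxy (by rw [h, lin_neg]))

theorem eq_of_reg_lin_eq_of_nonneg {x y c d : ℤ × ℤ} (hxy : |det x y| = 1)
    (hc : IsCoprime c.1 c.2) (hd : IsCoprime d.1 d.2) (hc1 : 0 ≤ c.1) (hc2 : 0 ≤ c.2)
    (hd1 : 0 ≤ d.1) (hd2 : 0 ≤ d.2) (hcd : reg (lin x y c) = reg (lin x y d)) : c = d := by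
  rcases eq_of_reg_lin_eq hxy hc hd hcd with h | h
  · exact h
  · rw [h] at hc1 hc2 ⊢
    simp only [Prod.fst_neg, Prod.snd_neg] at hc1 hc2
    ext <;> simp only [Prod.fst_neg, Prod.snd_neg] <;> omega

theorem reg_sub_notMem_closedCone {x y : ℤ × ℤ} (hxy : |det x y| = 1) :
    reg (x - y) ∉ closedCone x y := by
  rintro ⟨c, hc, h1, h2, h3⟩
  rw [← lin_one_neg_one] at h3
  rcases eq_of_reg_lin_eq hxy isCoprime_one_left hc h3 with h | h
  · rw [← h] at h2; norm_num at h2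
  · have : (1 : ℤ) = -c.1 := congrArg Prod.fst h
    omega

/-- Two nonnegative integer vectors of determinant `±1` are comparable unless they are the two
standard basis vectors. -/
theorem le_or_le_or_basis {c d : ℤ × ℤ} (hcd : |det c d| = 1) (hc1 : 0 ≤ c.1) (hc2 : 0 ≤ c.2)
    (hd1 : 0 ≤ d.1) (hd2 : 0 ≤ d.2) : c ≤ d ∨ d ≤ c ∨
      (c = (1, 0) ∧ d = (0, 1)) ∨ (c = (0, 1) ∧ d = (1, 0)) := by
  have aux : ∀ a b a' b' : ℤ, 0 ≤ b → 0 ≤ a' → a' < a → b < b' → |a * b' - b * a'| = 1 →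
      a = 1 ∧ b = 0 ∧ a' = 0 ∧ b' = 1 := by
    intro a b a' b' hb ha' h1 h2 h3
    obtain ⟨s, rfl⟩ : ∃ s, a = a' + 1 + s := ⟨a - a' - 1, by ring⟩
    obtain ⟨t, rfl⟩ : ∃ t, b' = b + 1 + t := ⟨b' - b - 1, by ring⟩
    have hs : 0 ≤ s := by omega
    have ht : 0 ≤ t := by omega
    have h4 : (a' + 1 + s) * (b + 1 + t) - b * a' ≤ 1 :=
      (le_abs_self _).trans h3.le
    have p1 := mul_nonneg ha' ht
    have p2 := mul_nonneg hs hb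
    have p3 := mul_nonneg hs ht
    have h5 : a' + b + s + t ≤ 0 := by nlinarith
    omega
  obtain ⟨a, b⟩ := c
  obtain ⟨a', b'⟩ := d
  simp only [det] at hcd hc1 hc2 hd1 hd2
  simp only [Prod.mk_le_mk, Prod.mk.injEq]
  rcases le_or_gt a a' with h1 | h1 <;> rcases le_or_gt b b' with h2 | h2
  · exact Or.inl ⟨h1, h2⟩
  · rcases h1.eq_or_lt with h1' | h1'
    · exact Or.inr (Or.inl ⟨h1'.ge, h2.le⟩)
    · have := aux a' b' a b hd2 hc1 h1' h2 (by rw [← hcd, ← abs_neg]; congr 1; ring)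
      omega
  · rcases h2.eq_or_lt with h2' | h2'
    · exact Or.inr (Or.inl ⟨h1.le, h2'.ge⟩)
    · have := aux a b a' b' hc2 hd1 h1 h2' hcd
      omega
  · exact Or.inr (Or.inl ⟨h1.le, h2.le⟩)

theorem add_mem_closedCone {x y c d : ℤ × ℤ} (hcd : |det c d| = 1) (hc1 : 0 ≤ c.1) (hc2 : 0 ≤ c.2)
    (hd1 : 0 ≤ d.1) (hd2 : 0 ≤ d.2) : reg (lin x y (c + d)) ∈ closedCone x y :=
  ⟨c + d, isCoprime_of_det (v := d) (by rwa [det_add_left]), add_nonneg hc1 hd1,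
    add_nonneg hc2 hd2, rfl⟩

theorem det_sub_left (c d : ℤ × ℤ) : det (c - d) d = det c d := by simp [det]; ring

theorem sub_mem_closedCone_of_le {x y c d : ℤ × ℤ} (hcd : |det c d| = 1) (hle : d ≤ c) :
    reg (lin x y (c - d)) ∈ closedCone x y :=
  ⟨c - d, isCoprime_of_det (v := d) (by rwa [det_sub_left]), sub_nonneg.2 hle.1,
    sub_nonneg.2 hle.2, rfl⟩

namespace DirectedEdge

variable {e : DirectedEdge} {x y : ℤ × ℤ}

theorem IsBasis.W_notMem (hb : e.IsBasis x y) : e.W ∉ closedCone x y :=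
  hb.W_eq ▸ reg_sub_notMem_closedCone hb.det_eq

theorem IsBasis.tail_subset (hb : e.IsBasis x y) : ∀ R ∈ e.tail.1, R ∈ closedCone x y := by
  intro R hR
  simp only [tail, Finset.mem_insert, Finset.mem_singleton] at hR
  rcases hR with rfl | rfl | rfl
  · exact ⟨(1, 0), isCoprime_one_left, by simp, by simp, by rw [lin_one_zero, hb.X_eq]⟩
  · exact ⟨(0, 1), isCoprime_one_right, by simp, by simp, by rw [lin_zero_one, hb.Y_eq]⟩
  · exact ⟨(1, 1), isCoprime_one_left, by simp, by simp, by rw [lin_one_one, hb.Z_eq]⟩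

/-- A vertex with the regions `e.X` and `e.Y` is an end point of `e`. -/
theorem IsBasis.eq_tail_or_eq_head (hb : e.IsBasis x y) {v : Vertex} (hX : e.X ∈ v.1)
    (hY : e.Y ∈ v.1) : v = e.tail ∨ v = e.head := by
  obtain ⟨T, hT, h1, h2⟩ := v.eq_insert hX hY e.adjXY.ne
  rw [hb.X_eq] at h1
  rw [hb.Y_eq] at h2
  rcases eq_reg_add_or_sub hb.det_eq h1 h2 with h | h
  · left; apply Subtype.ext; rw [hT, h, ← hb.Z_eq]; rfl
  · right; apply Subtype.ext; rw [hT, h, ← hb.W_eq]; rfl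

/-- `Σ⁻(e)` stays in the closed cone. -/
theorem IsBasis.subset_closedCone (hb : e.IsBasis x y) {v : Vertex} (hv : v ∈ e.sigmaMinus) :
    ∀ R ∈ v.1, R ∈ closedCone x y := by
  have hv' : Relation.ReflTransGen (tree.deleteEdges {s(e.tail, e.head)}).Adj e.tail v :=
    (SimpleGraph.reachable_iff_reflTransGen _ _).1 hv
  induction hv' with
  | refl => exact hb.tail_subset
  | @tail s t hs hst ih =>
    have ih := ih ((SimpleGraph.reachable_iff_reflTransGen _ _).2 hs)
    rw [SimpleGraph.deleteEdges_adj] at hst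
    obtain ⟨hadj, hdel⟩ := hst
    obtain ⟨R, S, hRS, hcap⟩ := Finset.card_eq_two.1 hadj
    have hR : R ∈ s.1 ∩ t.1 := by rw [hcap]; simp
    have hS : S ∈ s.1 ∩ t.1 := by rw [hcap]; simp
    rw [Finset.mem_inter] at hR hS
    -- an edge of the tree other than `e` does not leave the cone
    have hend : e.X ∈ s.1 → e.X ∈ t.1 → e.Y ∈ s.1 → e.Y ∈ t.1 →
        ∀ R ∈ t.1, R ∈ closedCone x y := by
      intro h1 h2 h3 h4
      rcases hb.eq_tail_or_eq_head h2 h4 with rfl | rfl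
      · exact hb.tail_subset
      · rcases hb.eq_tail_or_eq_head h1 h3 with rfl | rfl
        · exact absurd rfl hdel
        · exact absurd hadj (SimpleGraph.irrefl _)
    obtain ⟨T, hT, hRT, hST⟩ := t.eq_insert hR.2 hS.2 hRS
    have hadjRS := t.adj hR.2 hS.2 hRS
    obtain ⟨c, hc, hc1, hc2, rfl⟩ := ih R hR.1
    obtain ⟨d, hd, hd1, hd2, rfl⟩ := ih S hS.1
    rw [adj_reg_iff ((isCoprime_lin_iff hb.det_eq c).2 hc)
      ((isCoprime_lin_iff hb.det_eq d).2 hd)] at hadjRS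
    have hcd : |det c d| = 1 := by rwa [abs_det_lin hb.det_eq] at hadjRS
    have hTmem : T ∈ closedCone x y → ∀ R ∈ t.1, R ∈ closedCone x y := by
      intro h R hR'
      rw [hT] at hR'
      simp only [Finset.mem_insert, Finset.mem_singleton] at hR'
      rcases hR' with rfl | rfl | rfl
      · exact ih _ hR.1
      · exact ih _ hS.1
      · exact h
    rcases eq_reg_add_or_sub hadjRS hRT hST with h | h
    · rw [← lin_add] at h
      exact hTmem (h ▸ add_mem_closedCone hcd hc1 hc2 hd1 hd2)
    · rw [← lin_sub] at h
      rcases le_or_le_or_basis hcd hc1 hc2 hd1 hd2 with hle | hle | ⟨rfl, rfl⟩ | ⟨rfl, rfl⟩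
      · refine hTmem ?_
        rw [h, ← reg_neg, ← lin_neg, neg_sub]
        exact sub_mem_closedCone_of_le (by rwa [abs_det_swap]) hle
      · exact hTmem (h ▸ sub_mem_closedCone_of_le hcd hle)
      · rw [lin_one_zero, lin_zero_one, ← hb.X_eq, ← hb.Y_eq] at *
        exact hend hR.1 hR.2 hS.1 hS.2
      · rw [lin_one_zero, lin_zero_one, ← hb.X_eq, ← hb.Y_eq] at *
        exact hend hS.1 hS.2 hR.1 hR.2

/-- A triangle of the closed cone descends to the tail of `e`: the neighbouring triangle across the side
with corners `c`, `d` has smaller coordinates. -/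
theorem IsBasis.mem_sigmaMinus_of_eq (hb : e.IsBasis x y) (n : ℕ) : ∀ c d : ℤ × ℤ, |det c d| = 1 →
    0 ≤ c.1 → 0 ≤ c.2 → 0 ≤ d.1 → 0 ≤ d.2 → c.1 + c.2 + d.1 + d.2 ≤ n → ∀ v : Vertex,
    v.1 = {reg (lin x y c), reg (lin x y d), reg (lin x y (c + d))} → v ∈ e.sigmaMinus := by
  induction n with
  | zero =>
    intro c d hcd hc1 hc2 hd1 hd2 hn
    have h1 : c.1 = 0 := by push_cast at hn; omega
    have h2 : c.2 = 0 := by push_cast at hn; omega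
    simp [det, h1, h2] at hcd
  | succ n ih =>
    -- the case in which the triangle can be folded over the side with corners `c`, `d`
    have main : ∀ c d : ℤ × ℤ, |det c d| = 1 →
        0 ≤ c.1 → 0 ≤ c.2 → 0 ≤ d.1 → 0 ≤ d.2 → c.1 + c.2 + d.1 + d.2 ≤ (n + 1 : ℕ) → d ≤ c →
        ∀ v : Vertex, v.1 = {reg (lin x y c), reg (lin x y d), reg (lin x y (c + d))} →
        v ∈ e.sigmaMinus := by
      intro c d hcd hc1 hc2 hd1 hd2 hn hle v hv
      have hd0 : 0 < d.1 + d.2 := by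
        by_contra h0
        have h1 : d.1 = 0 := by omega
        have h2 : d.2 = 0 := by omega
        simp [det, h1, h2] at hcd
      have hcd' : |det (c - d) d| = 1 := by rwa [det_sub_left]
      have hdet' : |det (lin x y (c - d)) (lin x y d)| = 1 := by rwa [abs_det_lin hb.det_eq]
      set t := triangle (lin x y (c - d)) (lin x y d) hdet' with ht
      have htv : t.1 = {reg (lin x y (c - d)), reg (lin x y d), reg (lin x y (c - d + d))} := by
        rw [lin_add]; rfl
      have htm : t ∈ e.sigmaMinus := by
        refine ih (c - d) d hcd' (sub_nonneg.2 hle.1) (sub_nonneg.2 hle.2) hd1 hd2 ?_ t htv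
        simp only [Prod.fst_sub, Prod.snd_sub]
        push_cast at hn
        omega
      rw [sub_add_cancel] at htv
      have hcc := isCoprime_of_det hcd
      have hdd := isCoprime_of_det (u := d) (v := c) (by rwa [abs_det_swap])
      have hcdc := isCoprime_of_det hcd'
      have hadd := isCoprime_of_det (u := c + d) (v := d) (by rwa [det_add_left])
      have hDC : reg (lin x y (c - d)) ≠ reg (lin x y c) := fun h => by
        have := eq_of_reg_lin_eq_of_nonneg hb.det_eq hcdc hcc (sub_nonneg.2 hle.1)
          (sub_nonneg.2 hle.2) hc1 hc2 h
        have h1 := congrArg Prod.fst this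
        have h2 := congrArg Prod.snd this
        simp only [Prod.fst_sub, Prod.snd_sub] at h1 h2
        omega
      have hDD : reg (lin x y (c - d)) ≠ reg (lin x y d) := (adj_reg hdet').ne
      have hDS : reg (lin x y (c - d)) ≠ reg (lin x y (c + d)) := fun h => by
        have := eq_of_reg_lin_eq_of_nonneg hb.det_eq hcdc hadd (sub_nonneg.2 hle.1)
          (sub_nonneg.2 hle.2) (add_nonneg hc1 hd1) (add_nonneg hc2 hd2) h
        have h1 := congrArg Prod.fst this
        have h2 := congrArg Prod.snd this
        simp only [Prod.fst_sub, Prod.snd_sub, Prod.fst_add, Prod.snd_add] at h1 h2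
        omega
      have hCD : reg (lin x y c) ≠ reg (lin x y d) :=
        (adj_reg (by rwa [abs_det_lin hb.det_eq])).ne
      have hcap : t.1 ∩ v.1 = {reg (lin x y c), reg (lin x y d)} := by
        rw [htv, hv]
        ext R
        simp only [Finset.mem_inter, Finset.mem_insert, Finset.mem_singleton]
        constructor
        · rintro ⟨rfl | rfl | rfl, h2⟩
          · rcases h2 with h2 | h2 | h2
            · exact absurd h2 hDC
            · exact absurd h2 hDD
            · exact absurd h2 hDS
          · exact Or.inr rfl
          · exact Or.inl rfl
        · rintro (rfl | rfl)
          · exact ⟨Or.inr (Or.inr rfl), Or.inl rfl⟩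
          · exact ⟨Or.inr (Or.inl rfl), Or.inr (Or.inl rfl)⟩
      have hadj : tree.Adj t v := by
        change (t.1 ∩ v.1).card = 2
        rw [hcap, Finset.card_pair hCD]
      have hvK : ∀ R ∈ v.1, R ∈ closedCone x y := by
        intro R hR
        rw [hv] at hR
        simp only [Finset.mem_insert, Finset.mem_singleton] at hR
        rcases hR with rfl | rfl | rfl
        · exact ⟨c, hcc, hc1, hc2, rfl⟩
        · exact ⟨d, hdd, hd1, hd2, rfl⟩
        · exact add_mem_closedCone hcd hc1 hc2 hd1 hd2
      have hhead : e.W ∈ e.head.1 := by simp [head]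
      have hstep : (tree.deleteEdges {s(e.tail, e.head)}).Adj t v := by
        rw [SimpleGraph.deleteEdges_adj]
        refine ⟨hadj, fun hmem => ?_⟩
        rw [Set.mem_singleton_iff, Sym2.eq_iff] at hmem
        rcases hmem with ⟨-, h⟩ | ⟨h, -⟩
        · exact hb.W_notMem (hvK _ (h ▸ hhead))
        · exact hb.W_notMem (hb.subset_closedCone htm _ (h ▸ hhead))
      exact SimpleGraph.Reachable.trans htm hstep.reachable
    intro c d hcd hc1 hc2 hd1 hd2 hn v hv
    rcases le_or_le_or_basis hcd hc1 hc2 hd1 hd2 with hle | hle | ⟨rfl, rfl⟩ | ⟨rfl, rfl⟩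
    · refine main d c (by rwa [abs_det_swap]) hd1 hd2 hc1 hc2 (by omega) hle v ?_
      rw [hv, add_comm d c]
      ext R
      simp only [Finset.mem_insert, Finset.mem_singleton]
      tauto
    · exact main c d hcd hc1 hc2 hd1 hd2 hn hle v hv
    all_goals
      have : v = e.tail := by
        apply Subtype.ext
        rw [hv]
        simp only [Prod.mk_add_mk, add_zero, zero_add, lin_one_zero, lin_zero_one, lin_one_one,
          tail, hb.X_eq, hb.Y_eq, hb.Z_eq]
        try rw [Finset.insert_comm]
      rw [this]
      exact SimpleGraph.Reachable.refl _

/-- The corners of a triangle of the closed cone are `c`, `d` and `c + d` in some order. -/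
theorem IsBasis.mem_sigmaMinus (hb : e.IsBasis x y) {v : Vertex}
    (hv : ∀ R ∈ v.1, R ∈ closedCone x y) : v ∈ e.sigmaMinus := by
  obtain ⟨R, S, T, hRS, hRT, hST, hv'⟩ := SimpleGraph.is3Clique_iff.1 v.2
  have hR := hv R (by simp [hv'])
  have hS := hv S (by simp [hv'])
  have hT := hv T (by simp [hv'])
  obtain ⟨c, hc, hc1, hc2, rfl⟩ := hR
  obtain ⟨d, hd, hd1, hd2, rfl⟩ := hS
  obtain ⟨f, hf, hf1, hf2, rfl⟩ := hT
  have key : ∀ c d : ℤ × ℤ, |det c d| = 1 → 0 ≤ c.1 → 0 ≤ c.2 → 0 ≤ d.1 → 0 ≤ d.2 →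
      v.1 = {reg (lin x y c), reg (lin x y d), reg (lin x y (c + d))} → v ∈ e.sigmaMinus :=
    fun c d hcd h1 h2 h3 h4 =>
      hb.mem_sigmaMinus_of_eq (c.1 + c.2 + d.1 + d.2).toNat c d hcd h1 h2 h3 h4 (by omega) v
  have cop := fun c => isCoprime_lin_iff (x := x) (y := y) hb.det_eq c
  have hcd : |det c d| = 1 := by
    rwa [adj_reg_iff ((cop c).2 hc) ((cop d).2 hd), abs_det_lin hb.det_eq] at hRS
  have hcf : |det c f| = 1 := by
    rwa [adj_reg_iff ((cop c).2 hc) ((cop f).2 hf), abs_det_lin hb.det_eq] at hRT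
  have hdf : |det d f| = 1 := by
    rwa [adj_reg_iff ((cop d).2 hd) ((cop f).2 hf), abs_det_lin hb.det_eq] at hST
  rcases eq_reg_add_or_sub (by rwa [abs_det_lin hb.det_eq]) hRT hST with h | h
  · rw [← lin_add] at h
    refine key c d hcd hc1 hc2 hd1 hd2 ?_
    rw [hv', h]
  · rw [← lin_sub] at h
    rcases eq_of_reg_lin_eq hb.det_eq hf
      (isCoprime_of_det (v := d) (by rwa [det_sub_left])) h with h | h
    · refine key d f hdf hd1 hd2 hf1 hf2 ?_
      rw [hv', show d + f = c by rw [h]; abel]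
      ext R
      simp only [Finset.mem_insert, Finset.mem_singleton]
      tauto
    · refine key c f hcf hc1 hc2 hf1 hf2 ?_
      rw [hv', show c + f = d by rw [h]; abel]
      ext R
      simp only [Finset.mem_insert, Finset.mem_singleton]
      tauto

/-- `Ω⁻(e)` consists of the regions in the open cone of a basis adapted to `e`. -/
theorem IsBasis.mem_omegaMinus_iff (hb : e.IsBasis x y) (X : Region) :
    X ∈ e.omegaMinus ↔ ∃ p ∈ openCone, X = reg (lin x y (p.1, p.2)) := by
  constructor
  · intro hX
    obtain ⟨v, hv⟩ := exists_mem_vertex X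
    obtain ⟨c, hc, hc1, hc2, hXc⟩ := hb.subset_closedCone (hX v hv) X hv
    have hnot : ∀ R ∈ e.omegaMinus, R ∉ e.head.1 := fun R hR hR' =>
      hb.W_notMem (hb.subset_closedCone (hR _ hR') _ (by simp [head]))
    have h1 : c.1 ≠ 0 := by
      intro h0
      rw [h0, isCoprime_zero_left, Int.isUnit_iff] at hc
      have : c = (0, 1) := by
        ext
        · exact h0
        · simp only; omega
      refine hnot X hX ?_
      rw [hXc, this, lin_zero_one, ← hb.Y_eq]
      simp [head]
    have h2 : c.2 ≠ 0 := by
      intro h0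
      rw [h0, isCoprime_zero_right, Int.isUnit_iff] at hc
      have : c = (1, 0) := by
        ext
        · simp only; omega
        · exact h0
      refine hnot X hX ?_
      rw [hXc, this, lin_one_zero, ← hb.X_eq]
      simp [head]
    refine ⟨(c.1.toNat, c.2.toNat), ⟨by simp only; omega, by simp only; omega, ?_⟩, ?_⟩
    · rw [← Nat.isCoprime_iff_coprime]
      simpa [Int.toNat_of_nonneg hc1, Int.toNat_of_nonneg hc2] using hc
    · simpa [Int.toNat_of_nonneg hc1, Int.toNat_of_nonneg hc2] using hXc
  · rintro ⟨p, ⟨hp1, hp2, hp3⟩, rfl⟩ v hv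
    refine hb.mem_sigmaMinus fun R hR => ?_
    have hpc : IsCoprime ((p.1 : ℤ)) (p.2 : ℤ) := Nat.isCoprime_iff_coprime.2 hp3
    by_cases hne : reg (lin x y (p.1, p.2)) = R
    · exact ⟨(p.1, p.2), hpc, by simp, by simp, hne.symm⟩
    · have hadj := v.adj hv hR hne
      obtain ⟨c, hc⟩ := exists_lin_eq hb.det_eq (vec R)
      have hcR := isCoprime_vec R
      rw [← hc, isCoprime_lin_iff hb.det_eq] at hcR
      rw [← reg_vec R, ← hc] at hadj ⊢
      rw [adj_reg_iff ((isCoprime_lin_iff hb.det_eq _).2 hpc)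
        ((isCoprime_lin_iff hb.det_eq _).2 hcR), abs_det_lin hb.det_eq] at hadj
      simp only [det] at hadj
      have q1 : (0 : ℤ) < p.1 := by exact_mod_cast hp1
      have q2 : (0 : ℤ) < p.2 := by exact_mod_cast hp2
      rw [abs_eq zero_le_one] at hadj
      have hsign : (0 ≤ c.1 ∧ 0 ≤ c.2) ∨ (c.1 ≤ 0 ∧ c.2 ≤ 0) := by
        rcases le_or_gt 0 c.1 with h1 | h1 <;> rcases le_or_gt 0 c.2 with h2 | h2
        · exact Or.inl ⟨h1, h2⟩
        · rcases h1.eq_or_lt with h1' | h1'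
          · exact Or.inr ⟨h1'.ge, h2.le⟩
          · exfalso; rcases hadj with h | h <;> nlinarith
        · rcases h2.eq_or_lt with h2' | h2'
          · exact Or.inr ⟨h1.le, h2'.ge⟩
          · exfalso; rcases hadj with h | h <;> nlinarith
        · exact Or.inr ⟨h1.le, h2.le⟩
      rcases hsign with ⟨h1, h2⟩ | ⟨h1, h2⟩
      · exact ⟨c, hcR, h1, h2, rfl⟩
      · refine ⟨-c, by simpa using hcR.neg_neg, by simpa using h1, by simpa using h2, ?_⟩
        rw [lin_neg, reg_neg]

end DirectedEdge

/-! ### From regions to coordinates -/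

/-- A Markoff map in the coordinates of a basis of `ℤ²`. -/
theorem IsMarkoffMap.isMarkoffFun {μ : ℂ} {φ : Region → ℂ} (hφ : IsMarkoffMap μ φ) {x y : ℤ × ℤ}
    (hxy : |det x y| = 1) : IsMarkoffFun μ fun c => φ (reg (lin x y c)) where
  neg u := by simp only [lin_neg, reg_neg]
  vertex u v huv := by
    refine hφ.vertex _ _ _ (adj_reg ?_) (adj_reg ?_) (adj_reg ?_) <;> rw [abs_det_lin hxy]
    · exact huv
    · rwa [det_add_right]
    · rwa [abs_det_swap, det_add_left]
  edge u v huv := by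
    have hsub : |det u (u - v)| = 1 := by
      rw [show det u (u - v) = -det u v by simp [det]; ring, abs_neg, huv]
    have hsub' : |det v (u - v)| = 1 := by rwa [abs_det_swap, det_sub_left]
    refine hφ.edge ⟨reg (lin x y u), reg (lin x y v), reg (lin x y (u + v)), reg (lin x y (u - v)),
      adj_reg (by rwa [abs_det_lin hxy]), adj_reg (by rwa [abs_det_lin hxy, det_add_right]),
      adj_reg (by rwa [abs_det_lin hxy, abs_det_swap, det_add_left]),
      adj_reg (by rwa [abs_det_lin hxy]), adj_reg (by rwa [abs_det_lin hxy]), fun hZW => ?_⟩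
    have h0 : det u v ≠ 0 := by intro h0; simp [h0] at huv
    rcases eq_of_reg_lin_eq hxy (isCoprime_of_det (v := v) (by rwa [det_add_left]))
      (isCoprime_of_det (v := v) (by rwa [det_sub_left])) hZW with h | h
    · have h1 := congrArg Prod.fst h
      have h2 := congrArg Prod.snd h
      simp only [Prod.fst_add, Prod.snd_add, Prod.fst_sub, Prod.snd_sub] at h1 h2
      exact h0 (by rw [det, show v.1 = 0 by omega, show v.2 = 0 by omega]; ring)
    · have h1 := congrArg Prod.fst h
      have h2 := congrArg Prod.snd h
      simp only [Prod.fst_add, Prod.snd_add, Prod.fst_sub, Prod.snd_sub, Prod.fst_neg,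
        Prod.snd_neg] at h1 h2
      exact h0 (by rw [det, show u.1 = 0 by omega, show u.2 = 0 by omega]; ring)

theorem Psi_comm (μ x y z : ℂ) : Psi μ x y z = Psi μ y x z := by
  unfold Psi
  rw [mul_comm x y, mul_comm (Complex.sqrt (1 - μ / x ^ 2))]

theorem comb_standard (p : ℕ × ℕ) : comb (1, 0) (0, 1) p = ((p.1 : ℤ), (p.2 : ℤ)) := by
  ext <;> simp [comb]

/-- The identity for the edge `e` with sides `reg x`, `reg y`, where `S = Ω⁻(e)`, `reg (x - y)` is
the region at the head, and `reg x` is the region with value `±2`. -/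
theorem mcShane_of_basis {τ : ℂ} (hμ4 : τ + 2 ≠ 4) {φ : Region → ℂ} (hφ : IsMarkoffMap (τ + 2) φ)
    {x y : ℤ × ℤ} (hxy : |det x y| = 1) {S : Set Region}
    (hS : ∀ X, X ∈ S ↔ ∃ p ∈ openCone, X = reg (lin x y (p.1, p.2)))
    (hx : φ (reg x) = 2 ∨ φ (reg x) = -2) (hy : 2 < ‖φ (reg y)‖) (hgt : ∀ X ∈ S, 2 < ‖φ X‖) :
    (∀ X ∈ S, φ X ^ 2 ≠ τ + 2) ∧ Summable (fun X : S => ‖frakH τ (φ X)‖) ∧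
    (φ (reg y) ^ 2 ≠ τ + 2 → ∃ k : ℤ, hatFrakH τ (φ (reg x)) + hatFrakH τ (φ (reg y)) +
        ∑' X : S, frakH τ (φ X) =
      Psi (τ + 2) (φ (reg x)) (φ (reg y)) (φ (reg (x - y))) + k * (2 * Real.pi * Complex.I)) := by
  have hF := hφ.isMarkoffFun hxy
  set F : ℤ × ℤ → ℂ := fun c => φ (reg (lin x y c)) with hFdef
  have F10 : F (1, 0) = φ (reg x) := by simp only [hFdef, lin_one_zero]
  have F01 : F (0, 1) = φ (reg y) := by simp only [hFdef, lin_zero_one]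
  have F1m : F (1, -1) = φ (reg (x - y)) := by simp only [hFdef, lin_one_neg_one]
  rw [← F10] at hx
  rw [← F01] at hy
  obtain ⟨m, hm⟩ := hF.exists_parabolicCone hμ4 hx (fun n => by
    rcases Nat.eq_zero_or_pos n with rfl | hn
    · exact hy
    · exact hgt _ ((hS _).2 ⟨(n, 1), ⟨hn, one_pos, Nat.coprime_one_right n⟩, by simp⟩))
  have hcop : ∀ p : openCone, IsCoprime (p.1.1 : ℤ) (p.1.2 : ℤ) := fun p =>
    Nat.isCoprime_iff_coprime.2 p.2.2.2
  let j : openCone → S := fun p => ⟨reg (lin x y (p.1.1, p.1.2)), (hS _).2 ⟨p, p.2, rfl⟩⟩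
  have hj : Function.Bijective j := by
    constructor
    · intro p q hpq
      have h1 := eq_of_reg_lin_eq_of_nonneg hxy (hcop p) (hcop q) (by simp) (by simp) (by simp)
        (by simp) (congrArg Subtype.val hpq)
      simp only [Prod.mk.injEq, Nat.cast_inj] at h1
      exact Subtype.ext (Prod.ext h1.1 h1.2)
    · rintro ⟨X, hX⟩
      obtain ⟨p, hp, rfl⟩ := (hS X).1 hX
      exact ⟨⟨p, hp⟩, rfl⟩
  let E : openCone ≃ S := Equiv.ofBijective j hj
  have hE : ∀ p : openCone, φ (E p) = F (comb (1, 0) (0, 1) p) := fun p => by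
    rw [comb_standard]; rfl
  refine ⟨fun X hX => ?_, ?_, fun hyμ => ?_⟩
  · obtain ⟨p, hp, rfl⟩ := (hS X).1 hX
    refine hm.sq_ne (p := (p.1, p.2)) ⟨hcop ⟨p, hp⟩, ?_, ?_⟩ ?_
    · simp
    · exact Int.natCast_pos.2 hp.2.1
    · exact Int.natCast_pos.2 hp.1
  · rw [← E.summable_iff]
    have hs := hm.summable_norm_hTerm_comb hμ4 τ (u := (1, 0)) (v := (0, 1)) (by simp [det])
      (by simp) (by simp) (by simp) (by simp)
    refine hs.congr fun p => ?_
    rw [Function.comp_apply, hE, hTerm]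
  · have hsum : ∑' X : S, frakH τ (φ X) = coneSum (hTerm τ F) (1, 0) (0, 1) := by
      rw [← E.tsum_eq]
      exact tsum_congr fun p => by rw [hE, hTerm]
    rw [← F10, ← F01, ← F1m, hsum]
    rw [← F01] at hyμ
    have hx0 : F (1, 0) ≠ 0 := by rw [← norm_pos_iff, hm.norm_eq_two]; norm_num
    have hy0 : F (0, 1) ≠ 0 := by rw [← norm_pos_iff]; linarith
    have hxμ : F (1, 0) ^ 2 ≠ τ + 2 := by
      have : F (1, 0) ^ 2 = 4 := by rcases hx with h | h <;> rw [h] <;> norm_num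
      rw [this]; exact hμ4.symm
    have hdet : |det ((1 : ℤ), (0 : ℤ)) (0, 1)| = 1 := by simp [det]
    have hv := hF.vertex (1, 0) (0, 1) hdet
    have he := hF.edge (1, 0) (0, 1) hdet
    rw [show ((1 : ℤ), (0 : ℤ)) - (0, 1) = (1, -1) by ext <;> simp] at he
    rw [← Complex.exp_eq_exp_iff_exists_int, Complex.exp_add, Complex.exp_add,
      exp_Psi hx0 hy0 hxμ hyμ hv he, hm.exp_coneSum hμ4 hyμ]

end

end Markoff

theorem proposition3p9 (τ μ : ℂ) (hμ : μ = τ + 2) (hμ0 : μ ≠ 0) (hμ4 : μ ≠ 4)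
    (φ : Markoff.Region → ℂ) (hφ : Markoff.IsMarkoffMap μ φ)
    (e : Markoff.DirectedEdge) (X₀ Y₀ : Markoff.Region)
    (he : e.omegaZero = {X₀, Y₀})
    (hX₀ : φ X₀ = 2 ∨ φ X₀ = -2)
    (hΩ : Markoff.sublevel φ 2 ∩ e.omegaZeroMinus = {X₀}) :
    (∀ X ∈ e.omegaMinus, φ X ^ 2 ≠ μ) ∧
    Summable (fun X : e.omegaMinus => ‖Markoff.frakH τ (φ X)‖) ∧
    (φ Y₀ ^ 2 ≠ μ →
      ∃ k : ℤ, (∑ X ∈ e.omegaZero, Markoff.hatFrakH τ (φ X)) +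
          ∑' X : e.omegaMinus, Markoff.frakH τ (φ X) =
        Markoff.psi μ φ e + k * (2 * Real.pi * Complex.I)) := by
  subst hμ
  obtain ⟨x, y, hb⟩ := e.exists_isBasis
  have hXY : e.X ≠ e.Y := e.adjXY.ne
  have hS := hb.mem_omegaMinus_iff
  have hnot : e.X ∉ e.omegaMinus ∧ e.Y ∉ e.omegaMinus := by
    have h0 : ∀ R ∈ e.omegaMinus, R ∉ e.head.1 := fun R hR hR' =>
      hb.W_notMem (hb.subset_closedCone (hR _ hR') _ (by simp [Markoff.DirectedEdge.head]))
    constructor <;> intro hmem <;>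
      exact h0 _ hmem (by simp [Markoff.DirectedEdge.head])
  have hlarge : ∀ X ∈ e.omegaZeroMinus, X ≠ X₀ → 2 < ‖φ X‖ := by
    intro X hX hne
    by_contra hle
    have : X ∈ Markoff.sublevel φ 2 ∩ e.omegaZeroMinus := ⟨not_lt.1 hle, hX⟩
    rw [hΩ] at this
    exact hne this
  have hpair : ({X₀, Y₀} : Finset Markoff.Region) = {e.X, e.Y} := he.symm
  have hcases : (X₀ = e.X ∧ Y₀ = e.Y) ∨ (X₀ = e.Y ∧ Y₀ = e.X) := by
    have h1 : e.X ∈ ({X₀, Y₀} : Finset _) := by rw [hpair]; simp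
    have h2 : e.Y ∈ ({X₀, Y₀} : Finset _) := by rw [hpair]; simp
    simp only [Finset.mem_insert, Finset.mem_singleton] at h1 h2
    rcases h1 with h1 | h1 <;> rcases h2 with h2 | h2
    · exact absurd (h1.trans h2.symm) hXY
    · exact Or.inl ⟨h1.symm, h2.symm⟩
    · exact Or.inr ⟨h2.symm, h1.symm⟩
    · exact absurd (h1.trans h2.symm) hXY
  have hXmem : e.X ∈ e.omegaZeroMinus := Or.inl (by simp [Markoff.DirectedEdge.omegaZero])
  have hYmem : e.Y ∈ e.omegaZeroMinus := Or.inl (by simp [Markoff.DirectedEdge.omegaZero])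
  have hsum : ∑ X ∈ e.omegaZero, Markoff.hatFrakH τ (φ X) =
      Markoff.hatFrakH τ (φ e.X) + Markoff.hatFrakH τ (φ e.Y) := Finset.sum_pair hXY
  rw [hsum, Markoff.psi]
  rcases hcases with ⟨rfl, rfl⟩ | ⟨rfl, rfl⟩
  · have hgt : ∀ X ∈ e.omegaMinus, 2 < ‖φ X‖ := fun X hX =>
      hlarge X (Or.inr hX) fun h => hnot.1 (h ▸ hX)
    have hY := hlarge e.Y hYmem hXY.symm
    rw [hb.X_eq] at hX₀
    rw [hb.Y_eq] at hY
    rw [hb.X_eq, hb.Y_eq, hb.W_eq]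
    exact Markoff.mcShane_of_basis hμ4 hφ hb.det_eq hS hX₀ hY hgt
  · have hgt : ∀ X ∈ e.omegaMinus, 2 < ‖φ X‖ := fun X hX =>
      hlarge X (Or.inr hX) fun h => hnot.2 (h ▸ hX)
    have hX := hlarge e.X hXmem hXY
    have hS' : ∀ X, X ∈ e.omegaMinus ↔
        ∃ p ∈ Markoff.openCone, X = Markoff.reg (Markoff.lin y x (p.1, p.2)) := by
      intro X
      rw [hS]
      constructor <;> rintro ⟨p, ⟨h1, h2, h3⟩, rfl⟩ <;>
        exact ⟨p.swap, ⟨h2, h1, h3.symm⟩, by rw [← Markoff.lin_swap]; rfl⟩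
    have hW : Markoff.reg (x - y) = Markoff.reg (y - x) := by
      rw [← Markoff.reg_neg, neg_sub]
    rw [hb.Y_eq] at hX₀
    rw [hb.X_eq] at hX
    rw [hb.X_eq, hb.Y_eq, hb.W_eq, hW, Markoff.Psi_comm,
      add_comm (Markoff.hatFrakH τ (φ (Markoff.reg x)))]
    exact Markoff.mcShane_of_basis hμ4 hφ (by rw [Markoff.abs_det_swap]; exact hb.det_eq) hS' hX₀ hX hgt
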